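/- Let $H$ be a finite graph on $h$ vertices with chromatic number $r+1\ge 3$. Then there is a constant $C=C(H)>0$ such that the following holds for every $n$. If $G$ is a graph on $n$ vertices which is $H$-free (that is, $G$ contains no copy of $H$ as a not necessarily induced subgraph) and whose minimum degree satisfies $$\delta(G)\ \ge\ \left(\frac{r-1}{r}-\frac{1}{3hr^2}\right)n ,$$ then there is a set of at most $C\,n^{2-(r+1)/h}$ edges of $G$ whose deletion makes $G$ $r$-colorable. -/

import Mathlib

/-! Write `r = q + 1`, `h = |W|`, `η = 1 / (3hr²)` and `μ = 1/r + η`, so that every vertex has at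
most `μn` non-neighbours. By supersaturation (`exists_box_of_dense`) an `H`-free graph has few
`(r+1)`-cliques, while the degree condition gives many `r`-cliques. On average an `r`-clique then
has few extensions, and sorting vertices by their unique non-neighbour in such a clique gives a
partial `r`-partition with few inner edges. Minimizing inner edges plus a penalty per unassigned
vertex makes assigned vertices have at most `εn` neighbours in their own part and unassigned ones at
least `εn` in every part.

An assigned vertex thus spends almost all its non-neighbours on its own part `V_i`. It misses at
most `(μ + ε)n - |V_i|` vertices of any other part, and these deficits total only `O(rηn)`. Cliques
across the parts can therefore be built greedily, both inside the neighbourhood of an unassigned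
vertex and inside the common neighbourhood of `2h` vertices of one part.

The first makes the unassigned set bounded: otherwise `h` such vertices share a dense set of
`r`-cliques, whence a blow-up of `K_{r+1}` containing `H`. The second excludes `K_{s,h}` from the
inner graph, where `s = ⌊h/(r+1)⌋` is at least the size of a smallest colour class. Kővári–Sós–Turán
leaves `O(n^{2-1/s})` inner edges, and `1/s ≥ (r+1)/h`. Edges at unassigned vertices add only
`O(n)`. -/

open Finset

universe u v

/-! ### Boxes in dense tuple systems, greedy clique counts, Kővári–Sós–Turán -/

section BoxesAndGraphs

open scoped Classical

/-- Among sufficiently many dense subsets of a finite type, some `t` have dense intersection. -/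
theorem exists_dense_common_intersection {ε : ℝ} (hε : 0 < ε) (t : ℕ) :
    ∃ M : ℕ, ∃ ε' : ℝ, 0 < ε' ∧ ∀ {α : Type u} {Y : Type v} [Fintype Y]
      (B : Finset α) (E : α → Finset Y), M ≤ #B →
      (∀ b ∈ B, ε * Fintype.card Y ≤ #(E b)) →
      ∃ T ⊆ B, #T = t ∧ ε' * Fintype.card Y ≤ #{y | ∀ b ∈ T, y ∈ E b} := by
  -- Since `M * ε > 2 * t`, averaging puts at least an `ε / 2` fraction of `Y` in at least `t` of
  -- `M` chosen sets.
  obtain ⟨M₀, hM₀⟩ := exists_nat_gt (2 * t / ε)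
  set M := M₀ + t with hMdef
  have hM : 2 * t / ε < M := hM₀.trans_le (by rw [hMdef]; norm_cast; omega)
  have hM0 : (0 : ℝ) < M := lt_of_le_of_lt (by positivity) hM
  refine ⟨M, ε / 2 / 2 ^ M, by positivity, ?_⟩
  intro α Y _ B E hMB hE
  obtain ⟨B₀, hB₀, hcard⟩ := exists_subset_card_eq hMB
  set Y' : Finset Y := {y | t ≤ #{b ∈ B₀ | y ∈ E b}} with hY'
  have hcount : ∑ b ∈ B₀, #(E b) = ∑ y : Y, #{b ∈ B₀ | y ∈ E b} := by
    have := sum_card_bipartiteAbove_eq_sum_card_bipartiteBelow (fun (b : α) (y : Y) => y ∈ E b)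
      (s := B₀) (t := univ)
    simpa [bipartiteAbove, bipartiteBelow] using this
  have hupper : (∑ y : Y, #{b ∈ B₀ | y ∈ E b}) ≤ t * Fintype.card Y + M * #Y' := by
    calc (∑ y : Y, #{b ∈ B₀ | y ∈ E b}) ≤ ∑ y : Y, (t + if y ∈ Y' then M else 0) := by
          refine sum_le_sum fun y _ => ?_
          split_ifs with h
          · exact (card_filter_le _ _).trans (by omega)
          · simp only [hY', mem_filter, mem_univ, true_and, not_le] at h
            omega
      _ = t * Fintype.card Y + M * #Y' := by
          rw [sum_add_distrib, ← sum_filter]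
          simp [mul_comm]
  have hlower : (M : ℝ) * (ε * Fintype.card Y) ≤ ∑ b ∈ B₀, (#(E b) : ℝ) := by
    rw [← hcard, ← nsmul_eq_mul]
    exact card_nsmul_le_sum _ _ _ fun b hb => hE b (hB₀ hb)
  have hY'card : ε / 2 * Fintype.card Y ≤ #Y' := by
    have h1 : (∑ b ∈ B₀, (#(E b) : ℝ)) ≤ t * Fintype.card Y + M * #Y' := by
      exact_mod_cast hcount.trans_le hupper
    have h2 : (2 * t : ℝ) ≤ M * ε := by
      rw [div_lt_iff₀ hε] at hM; exact hM.le
    have h3 : (2 * t : ℝ) * Fintype.card Y ≤ M * ε * Fintype.card Y := by gcongr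
    have h4 : (M : ℝ) * (ε / 2 * Fintype.card Y) ≤ M * #Y' := by linarith
    exact le_of_mul_le_mul_left h4 hM0
  -- Each such `y` picks `t` of the sets containing it. There are `2 ^ M` subsets of `B₀`, so some
  -- `T` is picked by a `2 ^ (-M)` fraction.
  have hchoose : ∀ y : Y, ∃ T : Finset α, y ∈ Y' → T ⊆ {b ∈ B₀ | y ∈ E b} ∧ #T = t := by
    intro y
    by_cases hy : y ∈ Y'
    · obtain ⟨T, hT⟩ := exists_subset_card_eq (by simpa [hY'] using hy : t ≤ #{b ∈ B₀ | y ∈ E b})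
      exact ⟨T, fun _ => hT⟩
    · exact ⟨∅, fun h => absurd h hy⟩
  choose τ hτ using hchoose
  have hmaps : ∀ y ∈ Y', τ y ∈ B₀.powerset := fun y hy =>
    mem_powerset.2 ((hτ y hy).1.trans (filter_subset _ _))
  by_cases hne : Y'.Nonempty
  · obtain ⟨T, hT, hT2⟩ := exists_le_card_fiber_of_nsmul_le_card_of_maps_to hmaps
      ⟨∅, empty_mem_powerset _⟩ (b := (#Y' : ℝ) / 2 ^ M)
      (by
        rw [card_powerset, hcard, nsmul_eq_mul]
        push_cast
        exact (mul_div_cancel₀ _ (by positivity)).le)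
    have hYpos : (0 : ℝ) < #Y' := by exact_mod_cast hne.card_pos
    have hfib : (0 : ℝ) < #{y ∈ Y' | τ y = T} := lt_of_lt_of_le (by positivity) hT2
    obtain ⟨y₀, hy₀⟩ := card_pos.1 (by exact_mod_cast hfib : 0 < #{y ∈ Y' | τ y = T})
    simp only [mem_filter] at hy₀
    refine ⟨T, (mem_powerset.1 hT).trans hB₀, hy₀.2 ▸ (hτ y₀ hy₀.1).2, ?_⟩
    calc ε / 2 / 2 ^ M * Fintype.card Y = (ε / 2 * Fintype.card Y) / 2 ^ M := by ring
      _ ≤ #Y' / 2 ^ M := by gcongr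
      _ ≤ _ := hT2
      _ ≤ _ := by
        norm_cast
        refine card_le_card fun y hy => ?_
        simp only [mem_filter, mem_univ, true_and] at hy ⊢
        intro b hb
        rw [← hy.2] at hb
        exact (mem_filter.1 ((hτ y hy.1).1 hb)).2
  · have h0 : (Fintype.card Y : ℝ) ≤ 0 := by
      rw [not_nonempty_iff_eq_empty.1 hne] at hY'card
      simp only [card_empty, Nat.cast_zero] at hY'card
      by_contra! h
      nlinarith [mul_pos hε h]
    have h0' : (Fintype.card Y : ℝ) = 0 := le_antisymm h0 (by positivity)
    have htM : t ≤ #B := by omega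
    obtain ⟨T, hT, hTc⟩ := exists_subset_card_eq htM
    exact ⟨T, hT, hTc, by rw [h0']; simp⟩

/-- A dense set of `k`-tuples contains a combinatorial box with sides of size `t`. -/
theorem exists_box_of_dense (t : ℕ) : ∀ (k : ℕ) {ε : ℝ}, 0 < ε → ∃ N : ℕ,
    ∀ {V : Type u} [Fintype V] (E : Finset (Fin k → V)), N ≤ Fintype.card V →
      ε * (Fintype.card V : ℝ) ^ k ≤ #E →
      ∃ S : Fin k → Finset V, (∀ i, #(S i) = t) ∧ ∀ g, (∀ i, g i ∈ S i) → g ∈ E := by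
  intro k
  induction k with
  | zero =>
    intro ε hε
    refine ⟨0, fun {V} _ E _ hE => ⟨fun i => i.elim0, fun i => i.elim0, fun g _ => ?_⟩⟩
    have hpos : (0 : ℝ) < #E := by
      refine lt_of_lt_of_le ?_ hE
      simpa using hε
    obtain ⟨g', hg'⟩ := card_pos.1 (by exact_mod_cast hpos : 0 < #E)
    rwa [Subsingleton.elim g g']
  | succ k ih =>
    intro ε hε
    obtain ⟨M, ε', hε', hM⟩ := exists_dense_common_intersection.{u, u} (half_pos hε) t
    obtain ⟨N, hN⟩ := ih hε'
    obtain ⟨N', hN'⟩ := exists_nat_gt (M / (ε / 2))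
    refine ⟨N + N' + 1, ?_⟩
    intro V _ E hV hE
    set n : ℝ := (Fintype.card V : ℝ) with hn
    have hnpos : 0 < n := by rw [hn]; exact_mod_cast (by omega : 0 < Fintype.card V)
    set F : V → Finset (Fin k → V) := fun v => {g | (Fin.cons v g : Fin (k + 1) → V) ∈ E} with hF
    have hsum : #E = ∑ v, #(F v) := by
      rw [← card_sigma]
      refine card_bij' (fun g _ => ⟨g 0, Fin.tail g⟩) (fun p _ => Fin.cons p.1 p.2) ?_ ?_ ?_ ?_
      · intro g hg; simpa [hF] using hg
      · rintro ⟨v, g⟩ hg; simpa [hF] using hg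
      · intro g hg; simp
      · rintro ⟨v, g⟩ hg; simp
    -- An `ε / 2` fraction of the vertices have dense slices. Some `t` of these share a dense set of
    -- `k`-tuples, to which the induction hypothesis applies.
    set B : Finset V := {v | ε / 2 * n ^ k ≤ #(F v)} with hB
    have hFle : ∀ v, (#(F v) : ℝ) ≤ n ^ k := by
      intro v
      have := card_le_univ (F v)
      rw [Fintype.card_fun, Fintype.card_fin] at this
      rw [hn]
      exact_mod_cast this
    have hupper : (#E : ℝ) ≤ n * (ε / 2 * n ^ k) + #B * n ^ k := by
      rw [hsum]
      push_cast
      calc ∑ v, (#(F v) : ℝ) ≤ ∑ v, (ε / 2 * n ^ k + if v ∈ B then n ^ k else 0) := by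
            refine sum_le_sum fun v _ => ?_
            split_ifs with h
            · have := hFle v
              have : 0 ≤ ε / 2 * n ^ k := by positivity
              linarith
            · simp only [hB, mem_filter, mem_univ, true_and, not_le] at h
              linarith
        _ = _ := by
            rw [sum_add_distrib, ← sum_filter]
            simp [hn]
    have hBcard : ε / 2 * n ≤ #B := by
      have h1 : (ε / 2 * n) * n ^ k ≤ #B * n ^ k := by
        have : ε * n ^ (k + 1) ≤ n * (ε / 2 * n ^ k) + #B * n ^ k := hE.trans hupper
        rw [pow_succ] at this
        linarith
      exact le_of_mul_le_mul_right h1 (by positivity)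
    have hMB : M ≤ #B := by
      have h1 : (N' : ℝ) ≤ n := by rw [hn]; exact_mod_cast (by omega)
      have h2 : (M : ℝ) < N' * (ε / 2) := by rwa [div_lt_iff₀ (half_pos hε)] at hN'
      have h3 : (N' : ℝ) * (ε / 2) ≤ n * (ε / 2) := by gcongr
      exact_mod_cast (by linarith : (M : ℝ) ≤ #B)
    have hcardfun : (Fintype.card (Fin k → V) : ℝ) = n ^ k := by
      rw [Fintype.card_fun, Fintype.card_fin, hn]; push_cast; rfl
    obtain ⟨T, -, hTt, hT⟩ := hM B F hMB (fun b hb => by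
      rw [hcardfun]; simpa [hB] using hb)
    rw [hcardfun] at hT
    obtain ⟨S, hS, hSE⟩ := hN _ (by omega) hT
    refine ⟨Fin.cons T S, ?_, ?_⟩
    · intro i
      refine Fin.cases ?_ (fun i => ?_) i
      · simpa using hTt
      · simpa using hS i
    · intro g hg
      have h0 : g 0 ∈ T := by simpa using hg 0
      have := hSE (Fin.tail g) (fun i => by simpa [Fin.tail] using hg i.succ)
      simp only [mem_filter, mem_univ, true_and] at this
      simpa [hF] using this _ h0

variable {V : Type u}

/-- A blow-up of a complete graph with parts at least as large as the colour classes of `H`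
contains `H`. -/
theorem isContained_of_blowup {W : Type v} [Fintype W] {H : SimpleGraph W} {G : SimpleGraph V}
    {ι : Type*} [DecidableEq ι] (c : H.Coloring ι) (S : ι → Finset V)
    (hcard : ∀ j, #{w | c w = j} ≤ #(S j))
    (hadj : ∀ i j, i ≠ j → ∀ x ∈ S i, ∀ y ∈ S j, G.Adj x y) : H.IsContained G := by
  have h1 : ∀ j, Nonempty ({w // c w = j} ↪ S j) := fun j =>
    Function.Embedding.nonempty_of_card_le (by
      rw [Fintype.card_coe, Fintype.card_subtype]; exact hcard j)
  let e := fun j => (h1 j).some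
  let f : W → V := fun w => e (c w) ⟨w, rfl⟩
  have hf : ∀ w, f w ∈ S (c w) := fun w => (e (c w) ⟨w, rfl⟩).2
  have hfe : ∀ w j (h : c w = j), f w = e j ⟨w, h⟩ := by
    rintro w _ rfl; rfl
  refine ⟨SimpleGraph.Hom.toCopy ⟨f, ?_⟩ ?_⟩
  · intro a b hab
    exact hadj _ _ (c.valid hab) _ (hf _) _ (hf _)
  · intro a b hab
    change f a = f b at hab
    by_cases hc : c a = c b
    · rw [hfe a _ hc, hfe b _ rfl] at hab
      simpa using (e (c b)).injective (Subtype.ext hab)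
    · have := hadj _ _ hc _ (hf a) _ (hf b)
      rw [hab] at this
      exact absurd this (G.loopless.irrefl _)

/-- Greedy count of transversal cliques. -/
theorem pow_le_card_transversal_cliques [Fintype V] [Nonempty V]
    (G : SimpleGraph V) {m : ℝ} (hm : 0 ≤ m) : ∀ {k : ℕ} (X : Fin k → Finset V),
    (∀ (j : Fin k) (g : Fin k → V), (∀ i < j, g i ∈ X i) →
      m ≤ #{x ∈ X j | ∀ i < j, G.Adj (g i) x}) →
    m ^ k ≤ #{g : Fin k → V | (∀ i, g i ∈ X i) ∧ Pairwise fun i j => G.Adj (g i) (g j)} := by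
  intro k
  induction k with
  | zero =>
    intro X _
    simp [Pairwise]
  | succ k ih =>
    intro X hX
    -- `v₀` pads shorter tuples to full length; only coordinates below `j` are ever inspected.
    obtain ⟨v₀⟩ := ‹Nonempty V›
    have hk := ih (fun i => X i.castSucc) (by
      intro j g hg
      refine (hX j.castSucc (Fin.snoc g v₀ : Fin (k + 1) → V) ?_).trans ?_
      · intro i
        refine Fin.lastCases ?_ (fun i => ?_) i
        · intro h; exact absurd h (by simp [Fin.lt_def])
        · intro h; simpa using hg i (by simpa using h)
      · norm_cast
        refine card_le_card fun x hx => ?_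
        simp only [mem_filter] at hx ⊢
        refine ⟨hx.1, fun i hi => ?_⟩
        simpa using hx.2 i.castSucc (by simpa using hi))
    set A : Finset (Fin k → V) :=
      {g | (∀ i, g i ∈ X i.castSucc) ∧ Pairwise fun i j => G.Adj (g i) (g j)} with hA
    have hext : ∀ g ∈ A, m ≤ #{x ∈ X (Fin.last k) | ∀ i, G.Adj (g i) x} := by
      intro g hg
      simp only [hA, mem_filter, mem_univ, true_and] at hg
      refine (hX (Fin.last k) (Fin.snoc g v₀ : Fin (k + 1) → V) ?_).trans ?_
      · intro i
        refine Fin.lastCases ?_ (fun i => ?_) i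
        · intro h; exact absurd h (lt_irrefl _)
        · intro _; simpa using hg.1 i
      · norm_cast
        refine card_le_card fun x hx => ?_
        simp only [mem_filter] at hx ⊢
        refine ⟨hx.1, fun i => ?_⟩
        simpa using hx.2 i.castSucc (Fin.castSucc_lt_last i)
    calc m ^ (k + 1) = m ^ k * m := pow_succ _ _
      _ ≤ #A * m := by gcongr
      _ ≤ ∑ g ∈ A, (#{x ∈ X (Fin.last k) | ∀ i, G.Adj (g i) x} : ℝ) := by
        rw [← nsmul_eq_mul]; exact card_nsmul_le_sum _ _ _ hext
      _ = (#(A.sigma fun g => {x ∈ X (Fin.last k) | ∀ i, G.Adj (g i) x}) : ℝ) := by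
        rw [card_sigma]; push_cast; rfl
      _ ≤ _ := by
        norm_cast
        refine card_le_card_of_injOn (fun p => (Fin.snoc p.1 p.2 : Fin (k + 1) → V)) ?_ ?_
        · rintro ⟨g, x⟩ hp
          simp only [hA, coe_sigma, Set.mem_sigma_iff, mem_coe, mem_filter, mem_univ, true_and]
            at hp ⊢
          refine ⟨fun i => ?_, fun i j => ?_⟩
          · refine Fin.lastCases ?_ (fun i => ?_) i
            · simpa using hp.2.1
            · simpa using hp.1.1 i
          · refine Fin.lastCases ?_ (fun i => ?_) i <;> refine Fin.lastCases ?_ (fun j => ?_) j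
            · intro h; exact absurd rfl h
            · intro _; simpa using (hp.2.2 j).symm
            · intro _; simpa using hp.2.2 i
            · intro h; simpa using hp.1.2 (fun h' => h (by rw [h']))
        · rintro ⟨g, x⟩ - ⟨g', x'⟩ - h
          obtain ⟨rfl, rfl⟩ := Fin.snoc_injective2 h
          rfl

/-- A Kővári–Sós–Turán bound for the degree sum of a `K_{s,t}`-free graph. -/
theorem sum_degree_le_of_biclique_free [Fintype V] (G : SimpleGraph V)
    {s t : ℕ} (hs : 1 ≤ s) (ht : 1 ≤ t)
    (hfree : ∀ P Q : Finset V, #P = s → #Q = t → ¬ ∀ x ∈ P, ∀ y ∈ Q, G.Adj x y) :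
    (∑ v, (G.degree v : ℝ)) ≤ (t + s) * (Fintype.card V : ℝ) ^ (2 - 1 / (s : ℝ)) := by
  obtain hn | hn := Nat.eq_zero_or_pos (Fintype.card V)
  · have := Fintype.card_eq_zero_iff.1 hn
    simp only [univ_eq_empty, sum_empty]
    positivity
  set n : ℝ := (Fintype.card V : ℝ) with hndef
  have hn1 : 1 ≤ n := by rw [hndef]; exact_mod_cast hn
  have hs1 : (1 : ℝ) ≤ s := by exact_mod_cast hs
  -- Double count stars with `s` leaves: an `s`-set has fewer than `t` common neighbours.
  have hcount : ∑ v, (G.degree v).choose s ≤ (Fintype.card V).choose s * t := by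
    have h := sum_card_bipartiteAbove_eq_sum_card_bipartiteBelow
      (fun (v : V) (T : Finset V) => T ⊆ G.neighborFinset v)
      (s := univ) (t := powersetCard s univ)
    calc ∑ v, (G.degree v).choose s
        = ∑ v, #(bipartiteAbove (fun (v : V) (T : Finset V) => T ⊆ G.neighborFinset v)
            (powersetCard s univ) v) := by
          refine sum_congr rfl fun v _ => ?_
          rw [← G.card_neighborFinset_eq_degree, ← card_powersetCard]
          congr 1
          ext T
          simp [bipartiteAbove, mem_powersetCard, and_comm]
      _ = _ := h
      _ ≤ ∑ T ∈ powersetCard s (univ : Finset V), t := by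
          refine sum_le_sum fun T hT => ?_
          by_contra! hlt
          obtain ⟨Q, hQ, hQc⟩ := exists_subset_card_eq hlt.le
          refine hfree T Q (mem_powersetCard.1 hT).2 hQc fun x hx y hy => ?_
          have := (mem_filter.1 (hQ hy)).2 hx
          exact ((G.mem_neighborFinset _ _).1 this).symm
      _ = _ := by simp
  have hcount2 : ∑ v, (G.degree v + 1 - s) ^ s ≤ t * Fintype.card V ^ s := by
    calc ∑ v, (G.degree v + 1 - s) ^ s ≤ ∑ v, (G.degree v).descFactorial s :=
          sum_le_sum fun v _ => Nat.pow_sub_le_descFactorial _ _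
      _ = s.factorial * ∑ v, (G.degree v).choose s := by
          rw [mul_sum]; exact sum_congr rfl fun v _ => Nat.descFactorial_eq_factorial_mul_choose _ _
      _ ≤ s.factorial * ((Fintype.card V).choose s * t) := by gcongr
      _ = t * (Fintype.card V).descFactorial s := by
          rw [Nat.descFactorial_eq_factorial_mul_choose]; ring
      _ ≤ _ := by gcongr; exact Nat.descFactorial_le_pow _ _
  set Z : ℝ := ∑ v, ((G.degree v + 1 - s : ℕ) : ℝ) with hZ
  -- Power mean inequality. Truncated subtraction makes vertices of degree below `s` contribute zero
  -- to `Z`.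
  have hZs : Z ^ s ≤ t * n ^ s * n ^ (s - 1) := by
    obtain ⟨s', rfl⟩ : ∃ s', s = s' + 1 := ⟨s - 1, by omega⟩
    have := pow_sum_div_card_le_sum_pow (s := (univ : Finset V))
      (f := fun v => ((G.degree v + 1 - (s' + 1) : ℕ) : ℝ)) (fun _ _ => by positivity) s'
    rw [div_le_iff₀ (by rw [card_univ]; positivity), card_univ] at this
    refine this.trans ?_
    rw [Nat.add_sub_cancel]
    gcongr
    rw [hndef]
    exact_mod_cast hcount2
  have hZle : Z ≤ t * n ^ (2 - 1 / (s : ℝ)) := by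
    refine le_of_pow_le_pow_left₀ (by omega : s ≠ 0) (by positivity) (hZs.trans ?_)
    rw [mul_pow, ← Real.rpow_mul_natCast (by positivity), mul_assoc, ← pow_add]
    have he : (2 - 1 / (s : ℝ)) * s = ((s + (s - 1) : ℕ) : ℝ) := by
      have : (s : ℝ) ≠ 0 := by positivity
      push_cast [Nat.cast_sub hs]
      field_simp
      ring
    rw [he, Real.rpow_natCast]
    gcongr
    exact_mod_cast Nat.le_self_pow (by omega) t
  have hn_le : n ≤ n ^ (2 - 1 / (s : ℝ)) := by
    conv_lhs => rw [← Real.rpow_one n]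
    refine Real.rpow_le_rpow_of_exponent_le hn1 ?_
    have : 1 / (s : ℝ) ≤ 1 := by rw [div_le_one (by positivity)]; exact hs1
    linarith
  calc (∑ v, (G.degree v : ℝ)) ≤ ∑ v, (((G.degree v + 1 - s : ℕ) : ℝ) + s) := by
        refine sum_le_sum fun v _ => ?_
        norm_cast; omega
    _ = Z + n * s := by rw [sum_add_distrib, sum_const, card_univ, nsmul_eq_mul]
    _ ≤ t * n ^ (2 - 1 / (s : ℝ)) + n ^ (2 - 1 / (s : ℝ)) * s := by gcongr
    _ = _ := by ring

end BoxesAndGraphs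

/-! ### Counting cliques in `H`-free graphs -/

section CliqueTuples

open scoped Classical

variable {V : Type u} [Fintype V]

/-- The `k`-tuples of pairwise adjacent vertices. -/
noncomputable def cliqueTuples (G : SimpleGraph V) (k : ℕ) : Finset (Fin k → V) :=
  {g | Pairwise fun i j => G.Adj (g i) (g j)}

theorem mem_cliqueTuples {G : SimpleGraph V} {k : ℕ} {g : Fin k → V} :
    g ∈ cliqueTuples G k ↔ Pairwise fun i j => G.Adj (g i) (g j) := by
  simp [cliqueTuples]

theorem cons_mem_cliqueTuples {G : SimpleGraph V} {k : ℕ} {v : V} {g : Fin k → V}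
    (hg : g ∈ cliqueTuples G k) (hv : ∀ i, G.Adj v (g i)) :
    (Fin.cons v g : Fin (k + 1) → V) ∈ cliqueTuples G (k + 1) := by
  rw [mem_cliqueTuples] at hg ⊢
  intro i j
  refine Fin.cases ?_ (fun i => ?_) i <;> refine Fin.cases ?_ (fun j => ?_) j
  · intro h; exact absurd rfl h
  · intro _; simpa using hv j
  · intro _; simpa using (hv i).symm
  · intro h; simpa using hg (fun h' => h (by rw [h']))

theorem card_sub_sum_le_card_filter_forall {α β : Type*} (X : Finset α) (Z : Finset β)
    (R : β → α → Prop) :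
    (#X : ℝ) - ∑ z ∈ Z, (#{x ∈ X | ¬ R z x} : ℝ) ≤ #{x ∈ X | ∀ z ∈ Z, R z x} := by
  have h : X ⊆ {x ∈ X | ∀ z ∈ Z, R z x} ∪ Z.biUnion fun z => {x ∈ X | ¬ R z x} := by
    intro x hx
    by_cases h : ∀ z ∈ Z, R z x
    · exact mem_union_left _ (mem_filter.2 ⟨hx, h⟩)
    · push Not at h
      obtain ⟨z, hz, hzx⟩ := h
      exact mem_union_right _ (mem_biUnion.2 ⟨z, hz, by simp [hx, hzx]⟩)
  have h2 : #X ≤ #{x ∈ X | ∀ z ∈ Z, R z x} + ∑ z ∈ Z, #{x ∈ X | ¬ R z x} :=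
    (card_le_card h).trans ((card_union_le _ _).trans (by gcongr; exact card_biUnion_le))
  have h3 : (#X : ℝ) ≤ #{x ∈ X | ∀ z ∈ Z, R z x} + ∑ z ∈ Z, (#{x ∈ X | ¬ R z x} : ℝ) := by
    exact_mod_cast h2
  linarith

theorem card_not_adj_le {G : SimpleGraph V} {μ : ℝ} (v : V)
    (hdeg : (1 - μ) * Fintype.card V ≤ G.degree v) :
    (#{w | ¬ G.Adj v w} : ℝ) ≤ μ * Fintype.card V := by
  have h := card_filter_add_card_filter_not (s := (univ : Finset V)) (fun w => G.Adj v w)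
  have h1 : #{w | G.Adj v w} = G.degree v := by
    rw [← G.card_neighborFinset_eq_degree]; congr 1; ext; simp
  rw [h1, card_univ] at h
  have h2 : (G.degree v : ℝ) + #{w | ¬ G.Adj v w} = Fintype.card V := by exact_mod_cast h
  linarith

/-- If a box of tuples consists of cliques then its sides are completely joined. -/
theorem adj_of_box {G : SimpleGraph V} {k : ℕ} {S : Fin k → Finset V} {t : ℕ}
    (hS : ∀ i, #(S i) = t) (hbox : ∀ g, (∀ i, g i ∈ S i) → g ∈ cliqueTuples G k) {i j : Fin k}
    (hij : i ≠ j) {x y : V} (hx : x ∈ S i) (hy : y ∈ S j) : G.Adj x y := by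
  have hpos : ∀ k, (S k).Nonempty := fun k => by
    rw [← card_pos, hS k, ← hS i]; exact card_pos.2 ⟨x, hx⟩
  choose d hd using hpos
  have h := mem_cliqueTuples.1 (hbox (Function.update (Function.update d j y) i x) (fun k => by
    by_cases h1 : k = i
    · subst h1; simpa using hx
    · by_cases h2 : k = j
      · subst h2; simpa [h1] using hy
      · simpa [h1, h2] using hd k)) hij
  simpa [hij.symm] using h

/-- A property of all entries of the tuples of a box holds on its sides. -/
theorem forall_mem_of_box {V : Type*} {k : ℕ} {S : Fin k → Finset V} {t : ℕ} {p : V → Prop}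
    (hS : ∀ i, #(S i) = t) (hbox : ∀ g : Fin k → V, (∀ i, g i ∈ S i) → ∀ i, p (g i)) {i : Fin k} {x : V}
    (hx : x ∈ S i) : p x := by
  have hpos : ∀ k, (S k).Nonempty := fun k => by
    rw [← card_pos, hS k, ← hS i]; exact card_pos.2 ⟨x, hx⟩
  choose d hd using hpos
  have h := hbox (Function.update d i x) (fun k => by
    by_cases h1 : k = i
    · subst h1; simpa using hx
    · simpa [h1] using hd k) i
  simpa using h

section Embedding

variable {W : Type v} [Fintype W] {H : SimpleGraph W} {q : ℕ}

/-- A dense set of `(q + 2)`-cliques forces a copy of every `(q + 2)`-colourable graph. -/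
theorem exists_card_cliqueTuples_lt (c : H.Coloring (Fin (q + 2))) {ε : ℝ} (hε : 0 < ε) :
    ∃ n₀ : ℕ, ∀ {V : Type u} [Fintype V] (G : SimpleGraph V), n₀ ≤ Fintype.card V → H.Free G →
      (#(cliqueTuples G (q + 2)) : ℝ) ≤ ε * (Fintype.card V : ℝ) ^ (q + 2) := by
  obtain ⟨n₀, hn₀⟩ := exists_box_of_dense.{u} (Fintype.card W) (q + 2) hε
  refine ⟨n₀, fun {V} _ G hV hfree => ?_⟩
  by_contra! hlt
  obtain ⟨S, hS, hbox⟩ := hn₀ _ hV hlt.le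
  refine hfree (isContained_of_blowup c S (fun j => (card_le_univ _).trans (hS j).ge) ?_)
  intro i j hij x hx y hy
  exact adj_of_box hS hbox hij hx hy

/-- In an `H`-free graph only boundedly many vertices have dense sets of `(q + 1)`-cliques in
their neighbourhoods. -/
theorem exists_card_lt_of_dense_cliques_in_neighborhoods (c : H.Coloring (Fin (q + 2))) {ε : ℝ}
    (hε : 0 < ε) :
    ∃ M n₀ : ℕ, ∀ {V : Type u} [Fintype V] (G : SimpleGraph V) (B : Finset V),
      n₀ ≤ Fintype.card V → H.Free G →
      (∀ v ∈ B, ε * (Fintype.card V : ℝ) ^ (q + 1) ≤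
        #{g ∈ cliqueTuples G (q + 1) | ∀ i, G.Adj v (g i)}) → #B < M := by
  obtain ⟨M, ε', hε', hM⟩ := exists_dense_common_intersection.{u, u} hε (Fintype.card W)
  obtain ⟨n₀, hn₀⟩ := exists_box_of_dense.{u} (Fintype.card W) (q + 1) hε'
  refine ⟨M, n₀, fun {V} _ G B hV hfree hB => ?_⟩
  by_contra! hlt
  have hcardfun : (Fintype.card (Fin (q + 1) → V) : ℝ) = (Fintype.card V : ℝ) ^ (q + 1) := by
    rw [Fintype.card_fun, Fintype.card_fin]; push_cast; rfl
  obtain ⟨T, -, hT, hdense⟩ := hM B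
    (fun v => ({g ∈ cliqueTuples G (q + 1) | ∀ i, G.Adj v (g i)} : Finset (Fin (q + 1) → V))) hlt
    (by rwa [hcardfun])
  rw [hcardfun] at hdense
  obtain ⟨S, hS, hbox⟩ := hn₀ _ hV hdense
  simp only [mem_filter, mem_univ, true_and] at hbox
  have hTS : ∀ x ∈ T, ∀ i, ∀ y ∈ S i, G.Adj x y := fun x hx i y hy =>
    forall_mem_of_box hS (p := G.Adj x) (fun g hg => (hbox g hg x hx).2) hy
  have hSS : ∀ i j, i ≠ j → ∀ x ∈ S i, ∀ y ∈ S j, G.Adj x y := by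
    intro i j hij x hx y hy
    -- Box tuples are known to be cliques only through a member of `T`, so `T` must be nonempty; it
    -- has the same size as `S i`.
    have hW : 0 < #T := by rw [hT, ← hS i]; exact card_pos.2 ⟨x, hx⟩
    obtain ⟨b, hb⟩ := card_pos.1 hW
    exact adj_of_box hS (fun g hg => (hbox g hg b hb).1) hij hx hy
  refine hfree (isContained_of_blowup c (Fin.cons T S)
    (fun j => (card_le_univ _).trans ?_) ?_)
  · refine Fin.cases ?_ (fun j => ?_) j
    · simpa using hT.ge
    · simpa using (hS j).ge
  · intro i j
    refine Fin.cases ?_ (fun i => ?_) i <;> refine Fin.cases ?_ (fun j => ?_) j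
    · intro h; exact absurd rfl h
    · intro _ x hx y hy; exact hTS x (by simpa using hx) j y (by simpa using hy)
    · intro _ x hx y hy; exact (hTS y (by simpa using hy) i x (by simpa using hx)).symm
    · intro h x hx y hy
      exact hSS i j (fun h' => h (by rw [h'])) x (by simpa using hx) y (by simpa using hy)

/-- A complete bipartite graph with a dense set of `q`-cliques in its common neighbourhood yields
a copy of `H`. -/
theorem exists_not_dense_cliques_over_biclique (c : H.Coloring (Fin (q + 2))) {ε : ℝ}
    (hε : 0 < ε) :
    ∃ n₀ : ℕ, ∀ {V : Type u} [Fintype V] (G : SimpleGraph V) (P Q : Finset V),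
      n₀ ≤ Fintype.card V → H.Free G → #{w | c w = 0} ≤ #P → Fintype.card W ≤ #Q →
      (∀ x ∈ P, ∀ y ∈ Q, G.Adj x y) →
      (#{g ∈ cliqueTuples G q | ∀ z ∈ P ∪ Q, ∀ i, G.Adj z (g i)} : ℝ) <
        ε * (Fintype.card V : ℝ) ^ q := by
  obtain ⟨n₀, hn₀⟩ := exists_box_of_dense.{u} (Fintype.card W) q hε
  refine ⟨n₀, fun {V} _ G P Q hV hfree hP hQ hPQ => ?_⟩
  by_contra! hlt
  obtain ⟨S, hS, hbox⟩ := hn₀ _ hV hlt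
  simp only [mem_filter] at hbox
  have hZS : ∀ z ∈ P ∪ Q, ∀ i, ∀ y ∈ S i, G.Adj z y := fun z hz i y hy =>
    forall_mem_of_box hS (p := G.Adj z) (fun g hg => (hbox g hg).2 z hz) hy
  have hSS : ∀ i j, i ≠ j → ∀ x ∈ S i, ∀ y ∈ S j, G.Adj x y := fun i j hij x hx y hy =>
    adj_of_box hS (fun g hg => (hbox g hg).1) hij hx hy
  -- `P` hosts colour class `0` and need only be as large as that class; every other host has `|W|`
  -- vertices.
  refine hfree (isContained_of_blowup c (Fin.cons P (Fin.cons Q S)) ?_ ?_)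
  · intro j
    refine Fin.cases ?_ (fun j => ?_) j
    · simpa using hP
    · refine (card_le_univ _).trans ?_
      refine Fin.cases ?_ (fun j => ?_) j
      · simpa using hQ
      · simpa using (hS j).ge
  · have key : ∀ i j : Fin (q + 2), i < j →
        ∀ x ∈ (Fin.cons P (Fin.cons Q S) : Fin (q + 2) → Finset V) i,
        ∀ y ∈ (Fin.cons P (Fin.cons Q S) : Fin (q + 2) → Finset V) j, G.Adj x y := by
      intro i j
      refine Fin.cases ?_ (fun j => ?_) j
      · intro h; exact absurd h (by simp)
      refine Fin.cases ?_ (fun i => ?_) i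
      · refine Fin.cases ?_ (fun j => ?_) j
        · intro _ x hx y hy; exact hPQ x (by simpa using hx) y (by simpa using hy)
        · intro _ x hx y hy
          exact hZS x (mem_union_left _ (by simpa using hx)) j y (by simpa using hy)
      · refine Fin.cases ?_ (fun j => ?_) j
        · intro h; exact absurd h (by simp)
        refine Fin.cases ?_ (fun i => ?_) i
        · intro _ x hx y hy
          exact hZS x (mem_union_right _ (by simpa using hx)) j y (by simpa using hy)
        · intro h x hx y hy
          refine hSS i j (fun h' => ?_) x (by simpa using hx) y (by simpa using hy)
          subst h'; exact lt_irrefl _ h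
    intro i j hij x hx y hy
    rcases lt_or_gt_of_ne hij with h | h
    · exact key i j h x hx y hy
    · exact (key j i h y hy x hx).symm

end Embedding

/-! ### Averaging to a clique with few extensions -/

section FewExtensions

variable (G : SimpleGraph V) {q : ℕ}

theorem sum_card_common_neighbors_le :
    ∑ x ∈ cliqueTuples G (q + 1), #{v | ∀ i, G.Adj (x i) v} ≤ #(cliqueTuples G (q + 2)) := by
  rw [← card_sigma]
  refine card_le_card_of_injOn (fun p => (Fin.cons p.2 p.1 : Fin (q + 2) → V)) ?_ ?_
  · rintro ⟨x, v⟩ hp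
    simp only [coe_sigma, Set.mem_sigma_iff, mem_coe, mem_filter, mem_univ, true_and] at hp ⊢
    exact cons_mem_cliqueTuples hp.1 fun i => (hp.2 i).symm
  · rintro ⟨x, v⟩ - ⟨x', v'⟩ - h
    obtain ⟨rfl, rfl⟩ := Fin.cons_injective2 h
    rfl

/-- Replacing `x i` by the edge `uv` gives a clique with one more vertex. Remembering the discarded
`x i` makes this injective and costs the factor `|V|`. -/
theorem sum_card_edges_in_common_neighborhood_le (i : Fin (q + 1)) :
    ∑ x ∈ cliqueTuples G (q + 1),
      #{p : V × V | G.Adj p.1 p.2 ∧ ∀ j, j ≠ i → G.Adj (x j) p.1 ∧ G.Adj (x j) p.2} ≤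
    #(cliqueTuples G (q + 2)) * Fintype.card V := by
  rw [← card_sigma, ← card_univ, ← card_product]
  refine card_le_card_of_injOn
    (fun p => ((Fin.cons p.2.1 (Fin.cons p.2.2 fun j => p.1 (i.succAbove j)) : Fin (q + 2) → V),
      p.1 i)) ?_ ?_
  · rintro ⟨x, u, v⟩ hp
    simp only [coe_sigma, Set.mem_sigma_iff, mem_coe, mem_filter, mem_univ, true_and,
      mem_product, and_true] at hp ⊢
    refine cons_mem_cliqueTuples (cons_mem_cliqueTuples ?_ fun j => ?_) ?_
    · rw [mem_cliqueTuples] at hp ⊢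
      exact fun a b hab => hp.1 (fun h => hab (Fin.succAbove_right_injective h))
    · exact (hp.2.2 _ (Fin.succAbove_ne i j)).2.symm
    · intro j
      refine Fin.cases ?_ (fun j => ?_) j
      · simpa using hp.2.1
      · simpa using (hp.2.2 _ (Fin.succAbove_ne i j)).1.symm
  · rintro ⟨x, u, v⟩ - ⟨x', u', v'⟩ - h
    simp only [Prod.mk.injEq] at h
    obtain ⟨h1, h2⟩ := h
    obtain ⟨hu, h1⟩ := Fin.cons_injective2 h1
    obtain ⟨hv, h1⟩ := Fin.cons_injective2 h1
    have : x = x' := by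
      funext j
      rcases eq_or_ne j i with rfl | hj
      · exact h2
      · obtain ⟨k, rfl⟩ := Fin.exists_succAbove_eq hj
        exact congrFun h1 k
    rw [this, hu, hv]

/-- Summed over all `(q+1)`-cliques, the left side is at most `(q + 2) * n` times the number of
`(q+2)`-cliques: once from common neighbours, `q + 1` times from edges. Some clique does no worse
than the average. -/
theorem exists_clique_few_extensions {c ε₀ ε₁ : ℝ} (hc : 0 < c) (hV : 0 < Fintype.card V)
    (hmany : (c * Fintype.card V) ^ (q + 1) ≤ #(cliqueTuples G (q + 1)))
    (hfew : (#(cliqueTuples G (q + 2)) : ℝ) ≤ ε₀ * (Fintype.card V : ℝ) ^ (q + 2))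
    (hε : (q + 2) * ε₀ ≤ ε₁ * c ^ (q + 1)) :
    ∃ x ∈ cliqueTuples G (q + 1),
      (Fintype.card V : ℝ) * #{v | ∀ i, G.Adj (x i) v} +
        ∑ i, (#{p : V × V | G.Adj p.1 p.2 ∧
          ∀ j, j ≠ i → G.Adj (x j) p.1 ∧ G.Adj (x j) p.2} : ℝ) ≤
      ε₁ * (Fintype.card V : ℝ) ^ 2 := by
  set n : ℝ := (Fintype.card V : ℝ) with hn
  have hnpos : 0 < n := by rw [hn]; exact_mod_cast hV
  have hKpos : (0 : ℝ) < #(cliqueTuples G (q + 1)) := lt_of_lt_of_le (by positivity) hmany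
  by_contra! hlt
  have h1 := sum_lt_sum_of_nonempty
    (card_pos.1 (by exact_mod_cast hKpos : 0 < #(cliqueTuples G (q + 1)))) hlt
  rw [sum_const, nsmul_eq_mul, sum_add_distrib, ← mul_sum, sum_comm] at h1
  have h2 : (∑ x ∈ cliqueTuples G (q + 1), (#{v | ∀ i, G.Adj (x i) v} : ℝ)) ≤
      #(cliqueTuples G (q + 2)) := by exact_mod_cast sum_card_common_neighbors_le G
  have h3 : ∑ i : Fin (q + 1), ∑ x ∈ cliqueTuples G (q + 1),
      (#{p : V × V | G.Adj p.1 p.2 ∧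
          ∀ j, j ≠ i → G.Adj (x j) p.1 ∧ G.Adj (x j) p.2} : ℝ) ≤
      ∑ i : Fin (q + 1), (#(cliqueTuples G (q + 2)) : ℝ) * n := by
    refine sum_le_sum fun i _ => ?_
    rw [hn]
    exact_mod_cast sum_card_edges_in_common_neighborhood_le G i
  rw [sum_const, card_univ, Fintype.card_fin, nsmul_eq_mul] at h3
  push_cast at h3
  have h4 : n * ∑ x ∈ cliqueTuples G (q + 1), (#{v | ∀ i, G.Adj (x i) v} : ℝ) ≤
      n * #(cliqueTuples G (q + 2)) := by gcongr
  have hε₁ : 0 ≤ ε₁ := by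
    by_contra! hneg
    have : 0 ≤ ε₀ := by
      by_contra! h0
      have : ε₀ * n ^ (q + 2) < 0 := mul_neg_of_neg_of_pos h0 (by positivity)
      have h5 : (0 : ℝ) ≤ #(cliqueTuples G (q + 2)) := by positivity
      linarith
    have : ε₁ * c ^ (q + 1) < 0 := mul_neg_of_neg_of_pos hneg (by positivity)
    have : 0 ≤ ((q : ℝ) + 2) * ε₀ := by positivity
    linarith
  have h5 : (c * n) ^ (q + 1) * (ε₁ * n ^ 2) < (q + 2) * (n * (ε₀ * n ^ (q + 2))) := by
    calc (c * n) ^ (q + 1) * (ε₁ * n ^ 2) ≤ #(cliqueTuples G (q + 1)) * (ε₁ * n ^ 2) := by gcongr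
      _ < (q + 2) * (n * #(cliqueTuples G (q + 2))) := by linarith
      _ ≤ _ := by gcongr
  have h6 : (q + 2) * ε₀ * (n ^ (q + 2) * n) ≤ ε₁ * c ^ (q + 1) * (n ^ (q + 2) * n) := by gcongr
  have h7 : (c * n) ^ (q + 1) * (ε₁ * n ^ 2) = ε₁ * c ^ (q + 1) * (n ^ (q + 2) * n) := by
    rw [mul_pow]; ring
  linarith

end FewExtensions

end CliqueTuples

/-! ### Partial partitions and their local optimality -/

section Partitions

open scoped Classical

variable {V : Type u} [Fintype V] (G : SimpleGraph V)

/-- Ordered adjacent pairs inside a common part of a partial partition. -/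
noncomputable def innerPairs {ι : Type*} (f : V → Option ι) : Finset (V × V) :=
  {p | G.Adj p.1 p.2 ∧ f p.1 = f p.2 ∧ f p.1 ≠ none}

/-- A vertex joins part `i` when `x i` is its only non-neighbour in the clique, so an inner edge
lies in the common neighbourhood of the other `x j`. An unassigned vertex is either a common
neighbour, which is rare, or misses two clique vertices, which the degree bound limits. -/
theorem exists_partition_of_clique {q : ℕ} {μ ε₁ : ℝ} (hV : 0 < Fintype.card V)
    (hdeg : ∀ v, (1 - μ) * Fintype.card V ≤ G.degree v) (x : Fin (q + 1) → V)
    (hx : (Fintype.card V : ℝ) * #{v | ∀ i, G.Adj (x i) v} +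
        ∑ i, (#{p : V × V | G.Adj p.1 p.2 ∧
          ∀ j, j ≠ i → G.Adj (x j) p.1 ∧ G.Adj (x j) p.2} : ℝ) ≤
      ε₁ * (Fintype.card V : ℝ) ^ 2) :
    ∃ f : V → Option (Fin (q + 1)), (#(innerPairs G f) : ℝ) ≤ ε₁ * (Fintype.card V : ℝ) ^ 2 ∧
      (#{v | f v = none} : ℝ) ≤ ((q + 1) * μ - 1 + 2 * ε₁) * Fintype.card V := by
  set n : ℝ := (Fintype.card V : ℝ) with hn
  have hnpos : 0 < n := by rw [hn]; exact_mod_cast hV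
  let f : V → Option (Fin (q + 1)) := fun v =>
    if h : ∃ i, ∀ j, G.Adj (x j) v ↔ j ≠ i then some h.choose else none
  have hfsome : ∀ v i, f v = some i → ∀ j, G.Adj (x j) v ↔ j ≠ i := by
    intro v i h
    by_cases hv : ∃ i, ∀ j, G.Adj (x j) v ↔ j ≠ i
    · simp only [f, dif_pos hv, Option.some.injEq] at h
      rw [← h]; exact hv.choose_spec
    · simp [f, dif_neg hv] at h
  have hfnone : ∀ v, f v = none → ¬ ∃ i, ∀ j, G.Adj (x j) v ↔ j ≠ i := by
    intro v h hv
    simp [f, dif_pos hv] at h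
  refine ⟨f, ?_, ?_⟩
  · have hsub : innerPairs G f ⊆ univ.biUnion fun i : Fin (q + 1) =>
        ({p : V × V | G.Adj p.1 p.2 ∧ ∀ j, j ≠ i → G.Adj (x j) p.1 ∧ G.Adj (x j) p.2} :
          Finset (V × V)) := by
      rintro ⟨u, v⟩ hp
      simp only [innerPairs, mem_filter, mem_univ, true_and] at hp
      obtain ⟨i, hi⟩ := Option.ne_none_iff_exists'.1 hp.2.2
      simp only [mem_biUnion, mem_filter, mem_univ, true_and]
      exact ⟨i, hp.1, fun j hj => ⟨(hfsome u i hi j).2 hj,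
        (hfsome v i (hp.2.1 ▸ hi) j).2 hj⟩⟩
    have h1 : (#(innerPairs G f) : ℝ) ≤ ∑ i : Fin (q + 1), (#{p : V × V | G.Adj p.1 p.2 ∧
          ∀ j, j ≠ i → G.Adj (x j) p.1 ∧ G.Adj (x j) p.2} : ℝ) := by
      exact_mod_cast (card_le_card hsub).trans card_biUnion_le
    have h2 : 0 ≤ n * #{v | ∀ i, G.Adj (x i) v} := mul_nonneg hnpos.le (Nat.cast_nonneg _)
    linarith
  · have hcommon : (#{v | ∀ i, G.Adj (x i) v} : ℝ) ≤ ε₁ * n := by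
      have h2 : (0 : ℝ) ≤ ∑ i : Fin (q + 1), (#{p : V × V | G.Adj p.1 p.2 ∧
          ∀ j, j ≠ i → G.Adj (x j) p.1 ∧ G.Adj (x j) p.2} : ℝ) :=
        sum_nonneg fun _ _ => Nat.cast_nonneg _
      have h3 : n * #{v | ∀ i, G.Adj (x i) v} ≤ n * (ε₁ * n) := by
        calc _ ≤ ε₁ * n ^ 2 := by linarith
          _ = _ := by ring
      exact le_of_mul_le_mul_left h3 hnpos
    have hdouble : ∑ v, #{i | ¬ G.Adj (x i) v} = ∑ i, #{v | ¬ G.Adj (x i) v} := by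
      have := sum_card_bipartiteAbove_eq_sum_card_bipartiteBelow
        (fun (v : V) (i : Fin (q + 1)) => ¬ G.Adj (x i) v) (s := univ) (t := univ)
      simpa [bipartiteAbove, bipartiteBelow] using this
    -- The weight `2` covers a common neighbour, which misses nothing yet is unassigned and counts
    -- `2` on the left.
    have hpoint : ∀ v, 1 + (if f v = none then 1 else 0) ≤
        #{i | ¬ G.Adj (x i) v} + 2 * (if ∀ i, G.Adj (x i) v then 1 else 0) := by
      intro v
      by_cases hall : ∀ i, G.Adj (x i) v
      · simp only [hall]; split_ifs <;> simp_all
      · simp only [hall, if_false]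
        push Not at hall
        obtain ⟨i, hi⟩ := hall
        have hmem : i ∈ ({i | ¬ G.Adj (x i) v} : Finset (Fin (q + 1))) := by simpa using hi
        split_ifs with hnone
        · have hno := hfnone v hnone
          by_contra! hlt
          have h1 : #{i | ¬ G.Adj (x i) v} = 1 :=
            le_antisymm (by omega) (card_pos.2 ⟨i, hmem⟩)
          obtain ⟨k, hk⟩ := card_eq_one.1 h1
          refine hno ⟨k, fun j => ?_⟩
          have : j ∈ ({i | ¬ G.Adj (x i) v} : Finset (Fin (q + 1))) ↔ j = k := by
            rw [hk, mem_singleton]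
          simp only [mem_filter, mem_univ, true_and] at this
          rw [ne_eq, ← this, not_not]
        · have := card_pos.2 ⟨i, hmem⟩
          omega
    have hsum := sum_le_sum fun v (_ : v ∈ (univ : Finset V)) => hpoint v
    simp only [sum_add_distrib, ← mul_sum, sum_boole, sum_const, card_univ, smul_eq_mul,
      mul_one, Nat.cast_id] at hsum
    rw [hdouble] at hsum
    have hmiss : (∑ i, (#{v | ¬ G.Adj (x i) v} : ℝ)) ≤ (q + 1) * (μ * n) := by
      calc _ ≤ ∑ i : Fin (q + 1), μ * n := sum_le_sum fun i _ => card_not_adj_le _ (hdeg _)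
        _ = _ := by simp
    have hsum' : n + #{v | f v = none} ≤ (∑ i, (#{v | ¬ G.Adj (x i) v} : ℝ)) +
        2 * #{v | ∀ i, G.Adj (x i) v} := by
      rw [hn]; exact_mod_cast hsum
    linarith

theorem card_innerPairs_update {ι : Type*} [DecidableEq ι] (f : V → Option ι) (v : V) (i : ι) (hv : f v = none) :
    #(innerPairs G (Function.update f v (some i))) =
      #(innerPairs G f) + 2 * #{w | f w = some i ∧ G.Adj v w} := by
  set D : Finset V := {w | f w = some i ∧ G.Adj v w} with hD
  have hDv : v ∉ D := by simp [hD]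
  have heq : innerPairs G (Function.update f v (some i)) =
      innerPairs G f ∪ ({v} ×ˢ D ∪ D ×ˢ {v}) := by
    ext ⟨a, b⟩
    simp only [innerPairs, mem_union, mem_filter, mem_univ, true_and, mem_product, mem_singleton,
      hD]
    by_cases ha : a = v <;> by_cases hb : b = v
    · subst ha; subst hb; simp
    · subst ha
      simp only [Function.update_self, Function.update_of_ne hb, hv, hb]
      simp [and_comm, eq_comm]
    · subst hb
      simp only [Function.update_self, Function.update_of_ne ha, hv, ha]
      simp only [G.adj_comm a b]
      constructor
      · rintro ⟨h1, h2, h3⟩; exact Or.inr (Or.inr ⟨⟨h2, h1⟩, trivial⟩)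
      · rintro (⟨-, h2, h3⟩ | h | ⟨⟨h1, h2⟩, -⟩)
        · exact absurd h2 h3
        · exact h.1.elim
        · exact ⟨h2, h1, by simp [h1]⟩
    · simp [ha, hb]
  have hdisj1 : Disjoint (({v} : Finset V) ×ˢ D) (D ×ˢ {v}) := by
    rw [disjoint_left]
    rintro ⟨a, b⟩ h1 h2
    simp only [mem_product, mem_singleton] at h1 h2
    exact hDv (h1.1 ▸ h2.1)
  have hdisj2 : Disjoint (innerPairs G f) ({v} ×ˢ D ∪ D ×ˢ {v}) := by
    rw [disjoint_left]
    rintro ⟨a, b⟩ h1 h2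
    simp only [innerPairs, mem_filter, mem_univ, true_and] at h1
    simp only [mem_union, mem_product, mem_singleton] at h2
    rcases h2 with ⟨rfl, -⟩ | ⟨-, rfl⟩
    · exact h1.2.2 hv
    · exact h1.2.2 (h1.2.1.trans hv)
  rw [heq, card_union_of_disjoint hdisj2, card_union_of_disjoint hdisj1, card_product,
    card_product, card_singleton]
  ring

theorem card_none_update {ι : Type*} [DecidableEq ι] (f : V → Option ι) (v : V) (i : ι) (hv : f v = none) :
    #{w | f w = none} = #{w | Function.update f v (some i) w = none} + 1 := by
  have : ({w | f w = none} : Finset V) =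
      insert v ({w | Function.update f v (some i) w = none} : Finset V) := by
    ext w
    by_cases hw : w = v
    · subst hw; simp [hv]
    · simp [hw]
  rw [this, card_insert_of_notMem (by simp)]

/-- A partial partition minimizing inner edges plus a penalty for unassigned vertices. -/
theorem exists_locally_optimal_partition {ι : Type*} [DecidableEq ι] [Fintype ι] (f₀ : V → Option ι) (t : ℝ) :
    ∃ f : V → Option ι,
      (#(innerPairs G f) + 2 * t * #{v | f v = none} : ℝ) ≤
        #(innerPairs G f₀) + 2 * t * #{v | f₀ v = none} ∧
      (∀ v, f v = none → ∀ i, t ≤ #{w | f w = some i ∧ G.Adj v w}) ∧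
      ∀ v i, f v = some i → (#{w | f w = some i ∧ G.Adj v w} : ℝ) ≤ t := by
  -- Pairs are ordered, so placing `v` in part `i` adds twice its degree into that part; the penalty
  -- `2 * t` makes the threshold exactly `t`.
  obtain ⟨f, -, hf⟩ := exists_min_image (univ : Finset (V → Option ι))
    (fun f => (#(innerPairs G f) + 2 * t * #{v | f v = none} : ℝ)) ⟨f₀, mem_univ _⟩
  refine ⟨f, hf f₀ (mem_univ _), ?_, ?_⟩
  · intro v hv i
    have h := hf (Function.update f v (some i)) (mem_univ _)
    rw [card_innerPairs_update G f v i hv, card_none_update f v i hv] at h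
    push_cast at h
    linarith
  · intro v i hv
    have h := hf (Function.update f v none) (mem_univ _)
    have hback : Function.update (Function.update f v none) v (some i) = f := by
      rw [Function.update_idem, ← hv, Function.update_eq_self]
    have h1 := card_innerPairs_update G (Function.update f v none) v i (by simp)
    have h2 := card_none_update (Function.update f v none) v i (by simp)
    rw [hback] at h1 h2
    have h3 : ({w | Function.update f v none w = some i ∧ G.Adj v w} : Finset V) =
        ({w | f w = some i ∧ G.Adj v w} : Finset V) := by
      ext w
      by_cases hw : w = v
      · subst hw; simp
      · simp [hw]
    rw [h3] at h1
    rw [h1, h2] at h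
    push_cast at h
    linarith

variable {G}

/-- At least `|V_i| - t` of the at most `μn` non-neighbours of `v` lie in its own part, which leaves
only the rest for part `j`. -/
theorem card_missing_le {ι : Type*} [DecidableEq ι] {f : V → Option ι} {μ t : ℝ} {v : V} {i j : ι}
    (hdeg : (1 - μ) * Fintype.card V ≤ G.degree v)
    (hinner : (#{w | f w = some i ∧ G.Adj v w} : ℝ) ≤ t) (hij : j ≠ i) :
    (#{w | f w = some j ∧ ¬ G.Adj v w} : ℝ) ≤ μ * Fintype.card V + t - #{w | f w = some i} := by
  have h1 := card_filter_add_card_filter_not (s := ({w | f w = some i} : Finset V))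
    (fun w => G.Adj v w)
  rw [filter_filter, filter_filter] at h1
  have h2 : #{w | f w = some j ∧ ¬ G.Adj v w} + #{w | f w = some i ∧ ¬ G.Adj v w} ≤
      #{w | ¬ G.Adj v w} := by
    rw [← card_union_of_disjoint]
    · refine card_le_card fun w hw => ?_
      simp only [mem_union, mem_filter, mem_univ, true_and] at hw ⊢
      tauto
    · rw [disjoint_left]
      intro w hw hw'
      simp only [mem_filter, mem_univ, true_and] at hw hw'
      exact hij (Option.some.inj (hw.1.symm.trans hw'.1))
  have h3 := card_not_adj_le v hdeg
  have h1' : (#{w | f w = some i ∧ G.Adj v w} : ℝ) + #{w | f w = some i ∧ ¬ G.Adj v w} =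
      #{w | f w = some i} := by exact_mod_cast h1
  have h2' : (#{w | f w = some j ∧ ¬ G.Adj v w} : ℝ) + #{w | f w = some i ∧ ¬ G.Adj v w} ≤
      #{w | ¬ G.Adj v w} := by exact_mod_cast h2
  linarith

/-- An earlier vertex from part `i` rules out at most `a i` candidates in a later part, so the
greedy choice keeps `m` options at each step. -/
theorem pow_le_card_cliqueTuples_of_few_missing [Nonempty V] {ι : Type*} [DecidableEq ι] {f : V → Option ι}
    {a : ι → ℝ}
    (hmiss : ∀ v i j, f v = some i → j ≠ i → (#{w | f w = some j ∧ ¬ G.Adj v w} : ℝ) ≤ a i)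
    {k : ℕ} {e : Fin k → ι} (he : Function.Injective e) {X : Fin k → Finset V}
    (hX : ∀ j, ∀ w ∈ X j, f w = some (e j)) {m : ℝ} (hm : 0 ≤ m)
    (hcard : ∀ j, m + ∑ i ∈ Iio j, a (e i) ≤ #(X j)) :
    m ^ k ≤ #{g ∈ cliqueTuples G k | ∀ i, g i ∈ X i} := by
  refine (pow_le_card_transversal_cliques G hm X ?_).trans ?_
  · intro j g hg
    have h1 := card_sub_sum_le_card_filter_forall (X j) (Iio j) (fun i x => G.Adj (g i) x)
    have h2 : ∑ i ∈ Iio j, (#{x ∈ X j | ¬ G.Adj (g i) x} : ℝ) ≤ ∑ i ∈ Iio j, a (e i) := by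
      refine sum_le_sum fun i hi => ?_
      rw [mem_Iio] at hi
      refine le_trans ?_ (hmiss (g i) (e i) (e j) (hX i _ (hg i hi))
        (fun h => hi.ne' (he h)))
      norm_cast
      refine card_le_card fun w hw => ?_
      simp only [mem_filter, mem_univ, true_and] at hw ⊢
      exact ⟨hX j w hw.1, hw.2⟩
    simp only [mem_Iio] at h1
    have := hcard j
    linarith
  · norm_cast
    refine card_le_card fun g hg => ?_
    simp only [mem_filter, mem_univ, true_and, mem_cliqueTuples] at hg ⊢
    exact ⟨hg.2, hg.1⟩

end Partitions

/-! ### From the optimal partition to the edge bound -/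

section Main

open scoped Classical

variable {V : Type u} [Fintype V] {G : SimpleGraph V}

theorem sum_card_parts_add_card_none {ι : Type*} [DecidableEq ι] [Fintype ι] (f : V → Option ι) :
    ∑ i, (#{w | f w = some i} : ℝ) + #{w | f w = none} = Fintype.card V := by
  have h := card_eq_sum_card_fiberwise (s := (univ : Finset V)) (t := univ) (f := f)
    (fun _ _ => mem_coe.2 (mem_univ _))
  rw [Fintype.sum_option, card_univ] at h
  rw [h]; push_cast; ring

theorem degree_le_sum_add_card_none {ι : Type*} [DecidableEq ι] [Fintype ι] (f : V → Option ι) (v : V) :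
    (G.degree v : ℝ) ≤ ∑ i, (#{w | f w = some i ∧ G.Adj v w} : ℝ) + #{w | f w = none} := by
  have h := card_eq_sum_card_fiberwise (s := G.neighborFinset v) (t := univ) (f := f)
    (fun _ _ => mem_coe.2 (mem_univ _))
  rw [Fintype.sum_option, G.card_neighborFinset_eq_degree] at h
  have h1 : ∀ o, #{w ∈ G.neighborFinset v | f w = o} = #{w | f w = o ∧ G.Adj v w} := by
    intro o; congr 1; ext w; simp [and_comm]
  simp only [h1] at h
  have h2 : #{w | f w = none ∧ G.Adj v w} ≤ #{w | f w = none} :=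
    card_le_card fun w hw => by
      simp only [mem_filter, mem_univ, true_and] at hw ⊢; exact hw.1
  have h3 : G.degree v ≤ ∑ i, #{w | f w = some i ∧ G.Adj v w} + #{w | f w = none} := by omega
  exact_mod_cast h3

/-- A graph of large minimum degree has many cliques with `q + 1` vertices. -/
theorem pow_le_card_cliqueTuples [Nonempty V] {q : ℕ} {μ c : ℝ} (hc : 0 ≤ c) (hμ : 0 ≤ μ)
    (hcμ : c ≤ 1 - q * μ) (hdeg : ∀ v, (1 - μ) * Fintype.card V ≤ G.degree v) :
    (c * Fintype.card V) ^ (q + 1) ≤ #(cliqueTuples G (q + 1)) := by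
  refine (pow_le_card_transversal_cliques G (by positivity) (fun _ : Fin (q + 1) => univ) ?_).trans
    ?_
  · intro j g _
    have h1 := card_sub_sum_le_card_filter_forall (univ : Finset V) (Iio j)
      (fun i x => G.Adj (g i) x)
    have h2 : ∑ i ∈ Iio j, (#{x | ¬ G.Adj (g i) x} : ℝ) ≤ ∑ i ∈ Iio j, μ * Fintype.card V :=
      sum_le_sum fun i _ => card_not_adj_le _ (hdeg _)
    rw [sum_const, Fin.card_Iio, nsmul_eq_mul] at h2
    have h3 : ((j : ℕ) : ℝ) * (μ * Fintype.card V) ≤ q * (μ * Fintype.card V) := by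
      gcongr; omega
    have h4 : c * Fintype.card V ≤ (1 - q * μ) * Fintype.card V := by gcongr
    simp only [mem_Iio, card_univ] at h1
    linarith
  · norm_cast
    refine card_le_card fun g hg => ?_
    simp only [mem_filter, mem_univ, true_and] at hg
    exact mem_cliqueTuples.2 hg.2

/-! ### Numerical inequalities behind the constant `1 / (3hr²)` -/

section Parameters

variable {h r η : ℝ}

theorem one_div_le_one_sub (hr : 2 ≤ r) (hh : r + 1 ≤ h) (hη : 0 < η)
    (hone : 3 * h * r ^ 2 * η = 1) :
    1 / (2 * r) ≤ 1 - (r - 1) * ((3 * h * r + 1) * η) := by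
  have h1 : 1 / (2 * r) = 3 / 2 * h * r * η := by
    rw [div_eq_iff (by positivity)]; linarith
  rw [h1]
  have h2 : (r - 1) * η ≤ 3 / 2 * h * r * η := by
    gcongr; nlinarith
  linarith

/-- Both sides are in units of `n`. The right side is the degree bound less `r - 2` parts of maximal
size; the left is twice the room needed for greedy choices plus the unassigned vertices. -/
theorem neighborhood_parameters (hr : 2 ≤ r) (hh : r + 1 ≤ h) (hη : 0 < η)
    (hone : 3 * h * r ^ 2 * η = 1) {μ ε : ℝ} (hμ : μ = (3 * h * r + 1) * η)
    (hε : ε = 3 / 100 * η) :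
    2 * ε + 2 * (r * (μ + ε) - 1) + 3 * (r * η + 3 * ε) ≤ (1 - μ) - (r - 2) * (μ + ε) := by
  have h1 : (6 * r - 1 + (3 * r + 9) * (3 / 100)) * η ≤ 3 * h * r * η := by
    gcongr; nlinarith
  subst hμ hε
  linarith

/-- The factor is `2h` for the vertices of the biclique and `1` for the clique built so far. The
total deficit is close to `rη` and `μ` exceeds `3hrη`, so there is room. -/
theorem biclique_parameters (hr : 2 ≤ r) (hh : r + 1 ≤ h) (hη : 0 < η)
    (hone : 3 * h * r ^ 2 * η = 1) {μ ε : ℝ} (hμ : μ = (3 * h * r + 1) * η)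
    (hε : ε = 3 / 100 * η) :
    (2 * h + 1) * (r * (μ + ε) - 1 + ε) ≤ μ := by
  have h1 : (2 * h + 1) * (r + (r + 1) * (3 / 100)) * η ≤ (3 * h * r + 1) * η := by
    gcongr; nlinarith
  have h2 : r * (μ + ε) - 1 + ε = (r + (r + 1) * (3 / 100)) * η := by
    subst hμ hε; linarith
  rw [h2, hμ, ← mul_assoc]
  exact h1

end Parameters

/-! ### Greedy cliques across the parts -/

section Structure

variable {q : ℕ} {h η μ ε : ℝ} {f : V → Option (Fin (q + 1))}

/-- A vertex of a nonempty part misses a nonnegative number of vertices of some other part; a second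
part exists because `q ≥ 1`. -/
theorem card_part_le (hq : 1 ≤ q) (hε : 0 ≤ ε) (hμ : 0 ≤ μ)
    (hmiss : ∀ v i j, f v = some i → j ≠ i → (#{w | f w = some j ∧ ¬ G.Adj v w} : ℝ) ≤
      μ * Fintype.card V + ε * Fintype.card V - #{w | f w = some i}) (i : Fin (q + 1)) :
    0 ≤ μ * Fintype.card V + ε * Fintype.card V - (#{w | f w = some i} : ℝ) := by
  rcases Finset.eq_empty_or_nonempty ({w | f w = some i} : Finset V) with h0 | ⟨v, hv⟩
  · rw [h0]; simp; positivity
  · have : Nontrivial (Fin (q + 1)) := Fin.nontrivial_iff_two_le.2 (by omega)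
    obtain ⟨j, hj⟩ := exists_ne i
    exact (Nat.cast_nonneg _).trans (hmiss v i j (by simpa using hv) hj)

/-- All parts have size at most `(μ + ε)n`, so the degree of `v` forces its neighbourhood to be
large in every part except possibly one. Starting the greedy choice in that part, where no room for
deficits is needed, lets it run. -/
theorem pow_le_card_cliques_in_neighborhood (hq : 1 ≤ q) (hh : (q + 1 : ℝ) + 1 ≤ h) (hη : 0 < η)
    (hone : 3 * h * (q + 1 : ℝ) ^ 2 * η = 1) (hμ : μ = (3 * h * (q + 1) + 1) * η)
    (hε : ε = 3 / 100 * η) (hdeg : ∀ v, (1 - μ) * Fintype.card V ≤ G.degree v)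
    (hinner : ∀ v i, f v = some i →
      (#{w | f w = some i ∧ G.Adj v w} : ℝ) ≤ ε * Fintype.card V)
    (hnone : (#{w | f w = none} : ℝ) ≤ ((q + 1) * η + 3 * ε) * Fintype.card V) {v : V}
    (hv : ∀ i, ε * Fintype.card V ≤ #{w | f w = some i ∧ G.Adj v w}) :
    (ε * Fintype.card V) ^ (q + 1) ≤ #{g ∈ cliqueTuples G (q + 1) | ∀ i, G.Adj v (g i)} := by
  have : Nonempty V := ⟨v⟩
  have hq1 : (1 : ℝ) ≤ q := by exact_mod_cast hq
  have hh0 : 0 < h := by linarith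
  have hε0 : 0 ≤ ε := by rw [hε]; positivity
  have hμ0 : 0 ≤ μ := by rw [hμ]; positivity
  set n : ℝ := (Fintype.card V : ℝ) with hn
  have hn0 : 0 ≤ n := Nat.cast_nonneg _
  have hmiss : ∀ v i j, f v = some i → j ≠ i → (#{w | f w = some j ∧ ¬ G.Adj v w} : ℝ) ≤
      μ * n + ε * n - #{w | f w = some i} := fun v i j hvi hij =>
    card_missing_le (hdeg v) (hinner v i hvi) hij
  have ha := card_part_le hq hε0 hμ0 hmiss
  set y : Fin (q + 1) → ℝ := fun i => (#{w | f w = some i ∧ G.Adj v w} : ℝ) with hy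
  have hyle : ∀ i, y i ≤ (μ + ε) * n := by
    intro i
    have h1 : y i ≤ #{w | f w = some i} := by
      simp only [hy]; norm_cast
      exact card_le_card fun w hw => by
        simp only [mem_filter, mem_univ, true_and] at hw ⊢; exact hw.1
    have := ha i
    linarith
  obtain ⟨k₀, -, hk₀⟩ := exists_min_image (univ : Finset (Fin (q + 1))) y ⟨0, mem_univ _⟩
  set a : Fin (q + 1) → ℝ := fun i => μ * n + ε * n - (#{w | f w = some i} : ℝ) with hadef
  have hsum_a : ∑ i, a i = ((q + 1) * (μ + ε) - 1) * n + #{w | f w = none} := by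
    have := sum_card_parts_add_card_none f
    simp only [hadef, sum_sub_distrib, sum_const, card_univ, Fintype.card_fin, nsmul_eq_mul]
    push_cast
    linarith
  have hlarge : ∀ k, k ≠ k₀ → ε * n + ∑ i, a i ≤ y k := by
    intro k hk
    -- By minimality of `y k₀` the first two terms are at most `2 * y k`; the remaining `q - 1`
    -- parts are bounded by their maximal size.
    have h1 : ∑ i, y i ≤ y k + y k₀ + (q - 1) * ((μ + ε) * n) := by
      rw [← add_sum_erase univ y (mem_univ k), ← add_sum_erase (univ.erase k) y
        (mem_erase.2 ⟨hk.symm, mem_univ k₀⟩), ← add_assoc]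
      gcongr
      refine (sum_le_card_nsmul _ _ _ fun i _ => hyle i).trans ?_
      rw [card_erase_of_mem (mem_erase.2 ⟨hk.symm, mem_univ k₀⟩), card_erase_of_mem (mem_univ k),
        card_univ, Fintype.card_fin, nsmul_eq_mul, Nat.add_sub_cancel, Nat.cast_sub hq,
        Nat.cast_one]
    have h2 := degree_le_sum_add_card_none (G := G) f v
    have h3 := hdeg v
    have h4 := hk₀ k (mem_univ k)
    have h5 := neighborhood_parameters (by linarith : (2 : ℝ) ≤ q + 1) hh hη hone hμ hε
    have h6 := mul_le_mul_of_nonneg_right h5 hn0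
    linarith
  refine (pow_le_card_cliqueTuples_of_few_missing (G := G) (a := a) hmiss
    (e := Equiv.swap 0 k₀) (Equiv.injective _)
    (X := fun j => ({w | f w = some (Equiv.swap 0 k₀ j) ∧ G.Adj v w} : Finset V)) ?_
    (by positivity) ?_).trans ?_
  · intro j w hw
    exact (mem_filter.1 hw).2.1
  · intro j
    rcases eq_or_ne j 0 with rfl | hj
    · have h0 : Iio (0 : Fin (q + 1)) = ∅ := by ext; simp
      rw [h0, sum_empty, add_zero]
      exact hv _
    · have hne : Equiv.swap 0 k₀ j ≠ k₀ := by
        intro h'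
        rw [Equiv.swap_apply_eq_iff, Equiv.swap_apply_right] at h'
        exact hj h'
      refine le_trans ?_ (hlarge _ hne)
      gcongr
      calc ∑ i ∈ Iio j, a (Equiv.swap 0 k₀ i) ≤ ∑ i, a (Equiv.swap 0 k₀ i) :=
            sum_le_univ_sum_of_nonneg fun i => ha _
        _ = ∑ i, a i := Equiv.sum_comp _ a
  · norm_cast
    refine card_le_card fun g hg => ?_
    simp only [mem_filter, mem_univ, true_and] at hg ⊢
    exact ⟨hg.1, fun i => (hg.2 i).2⟩

/-- Each `z ∈ Z` loses at most `a i₀` candidates in any other part, and each earlier clique vertex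
the deficit of its own part. Altogether this is at most `2h + 1` times the total deficit. -/
theorem pow_le_card_cliques_over_biclique (hq : 1 ≤ q) (hh : (q + 1 : ℝ) + 1 ≤ h) (hη : 0 < η)
    (hone : 3 * h * (q + 1 : ℝ) ^ 2 * η = 1) (hμ : μ = (3 * h * (q + 1) + 1) * η)
    (hε : ε = 3 / 100 * η) (hdeg : ∀ v, (1 - μ) * Fintype.card V ≤ G.degree v)
    (hinner : ∀ v i, f v = some i →
      (#{w | f w = some i ∧ G.Adj v w} : ℝ) ≤ ε * Fintype.card V)
    (hnone : (#{w | f w = none} : ℝ) ≤ ε * Fintype.card V) [Nonempty V] {i₀ : Fin (q + 1)}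
    {Z : Finset V} (hZ : ∀ z ∈ Z, f z = some i₀) (hZcard : (#Z : ℝ) ≤ 2 * h) :
    (ε * Fintype.card V) ^ q ≤ #{g ∈ cliqueTuples G q | ∀ z ∈ Z, ∀ i, G.Adj z (g i)} := by
  have hq1 : (1 : ℝ) ≤ q := by exact_mod_cast hq
  have hh0 : 0 < h := by linarith
  have hε0 : 0 ≤ ε := by rw [hε]; positivity
  have hμ0 : 0 ≤ μ := by rw [hμ]; positivity
  set n : ℝ := (Fintype.card V : ℝ) with hn
  have hn0 : 0 ≤ n := Nat.cast_nonneg _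
  have hmiss : ∀ v i j, f v = some i → j ≠ i → (#{w | f w = some j ∧ ¬ G.Adj v w} : ℝ) ≤
      μ * n + ε * n - #{w | f w = some i} := fun v i j hvi hij =>
    card_missing_le (hdeg v) (hinner v i hvi) hij
  have ha := card_part_le hq hε0 hμ0 hmiss
  set a : Fin (q + 1) → ℝ := fun i => μ * n + ε * n - (#{w | f w = some i} : ℝ) with hadef
  have hsum_a : ∑ i, a i ≤ ((q + 1) * (μ + ε) - 1 + ε) * n := by
    have := sum_card_parts_add_card_none f
    simp only [hadef, sum_sub_distrib, sum_const, card_univ, Fintype.card_fin, nsmul_eq_mul]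
    push_cast
    linarith
  have hsum_nonneg : 0 ≤ ∑ i, a i := sum_nonneg fun i _ => ha i
  refine (pow_le_card_cliqueTuples_of_few_missing (G := G) (a := a) hmiss
    (e := i₀.succAbove) Fin.succAbove_right_injective
    (X := fun j => ({w ∈ ({w | f w = some (i₀.succAbove j)} : Finset V) |
      ∀ z ∈ Z, G.Adj z w} : Finset V)) ?_ (by positivity) ?_).trans ?_
  · intro j w hw
    simp only [mem_filter, mem_univ, true_and] at hw
    exact hw.1
  · intro j
    have h1 := card_sub_sum_le_card_filter_forall
      ({w | f w = some (i₀.succAbove j)} : Finset V) Z (fun z w => G.Adj z w)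
    have h2 : ∑ z ∈ Z, (#{w ∈ ({w | f w = some (i₀.succAbove j)} : Finset V) |
        ¬ G.Adj z w} : ℝ) ≤ 2 * h * ∑ i, a i := by
      calc _ ≤ ∑ z ∈ Z, a i₀ := by
            refine sum_le_sum fun z hz => ?_
            rw [filter_filter]
            exact hmiss z i₀ _ (hZ z hz) (Fin.succAbove_ne _ _)
        _ = #Z * a i₀ := by rw [sum_const, nsmul_eq_mul]
        _ ≤ 2 * h * ∑ i, a i := by
            gcongr
            · exact ha i₀
            · exact single_le_sum (fun i _ => ha i) (mem_univ i₀)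
    have h3 : a (i₀.succAbove j) + ∑ i ∈ Iio j, a (i₀.succAbove i) ≤ ∑ i, a i := by
      rw [← sum_insert (f := fun i => a (i₀.succAbove i)) (by simp : j ∉ Iio j),
        ← sum_image (f := a) (g := i₀.succAbove)
          (fun _ _ _ _ hab => Fin.succAbove_right_injective hab)]
      exact sum_le_univ_sum_of_nonneg ha
    have h4 := biclique_parameters (by linarith : (2 : ℝ) ≤ q + 1) hh hη hone hμ hε
    have h5 : (2 * h + 1) * ∑ i, a i ≤ μ * n := by
      calc _ ≤ (2 * h + 1) * (((q + 1) * (μ + ε) - 1 + ε) * n) := by gcongr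
        _ = (2 * h + 1) * ((q + 1) * (μ + ε) - 1 + ε) * n := by ring
        _ ≤ μ * n := by gcongr
    have h6 : a (i₀.succAbove j) = μ * n + ε * n - #{w | f w = some (i₀.succAbove j)} := rfl
    refine le_trans ?_ (h1.trans (le_of_eq (by congr)))
    linarith
  · norm_cast
    refine card_le_card fun g hg => ?_
    simp only [mem_filter, mem_univ, true_and] at hg ⊢
    exact ⟨hg.1, fun z hz i => (hg.2 i).2 z hz⟩

end Structure

/-- The edges of `G` inside a common part of a partial partition. -/
def innerGraph {ι : Type*} (G : SimpleGraph V) (f : V → Option ι) : SimpleGraph V where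
  Adj u v := G.Adj u v ∧ f u = f v ∧ f u ≠ none
  symm := ⟨fun _ _ h => ⟨h.1.symm, h.2.1.symm, h.2.1 ▸ h.2.2⟩⟩
  loopless := ⟨fun _ h => G.loopless.irrefl _ h.1⟩

/-! ### Bounded exceptional set and excluded bicliques -/

section Existence

variable {W : Type v} [Fintype W] {H : SimpleGraph W} {q : ℕ} {η μ ε : ℝ}

theorem exists_partition_with_bounded_exceptional_set (c : H.Coloring (Fin (q + 2))) (hq : 1 ≤ q)
    (hh : q + 2 ≤ Fintype.card W) (hη : 0 < η)
    (hone : 3 * (Fintype.card W : ℝ) * (q + 1 : ℝ) ^ 2 * η = 1)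
    (hμ : μ = (3 * (Fintype.card W : ℝ) * (q + 1) + 1) * η) (hε : ε = 3 / 100 * η) :
    ∃ M n₀ : ℕ, ∀ {V : Type u} [Fintype V] (G : SimpleGraph V), n₀ ≤ Fintype.card V → H.Free G →
      (∀ v, (1 - μ) * Fintype.card V ≤ G.degree v) →
      ∃ f : V → Option (Fin (q + 1)), #{v | f v = none} < M ∧
        ∀ v i, f v = some i → (#{w | f w = some i ∧ G.Adj v w} : ℝ) ≤ ε * Fintype.card V := by
  have hh' : (q + 1 : ℝ) + 1 ≤ Fintype.card W := by
    have : ((q + 2 : ℕ) : ℝ) ≤ Fintype.card W := by exact_mod_cast hh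
    push_cast at this; linarith
  have hq1 : (1 : ℝ) ≤ q := by exact_mod_cast hq
  have hε0 : 0 < ε := by rw [hε]; positivity
  have hμ0 : 0 ≤ μ := by rw [hμ]; positivity
  have hη1 : η ≤ 1 := by
    have : (1 : ℝ) ≤ 3 * (Fintype.card W : ℝ) * (q + 1 : ℝ) ^ 2 := by nlinarith
    calc η = 1 * η := (one_mul _).symm
      _ ≤ 3 * (Fintype.card W : ℝ) * (q + 1 : ℝ) ^ 2 * η := by gcongr
      _ = 1 := hone
  have hε1 : ε ≤ 1 := by rw [hε]; linarith
  set κ : ℝ := 1 / (2 * ((q : ℝ) + 1)) with hκ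
  have hκ0 : 0 < κ := by positivity
  obtain ⟨n₁, hn₁⟩ := exists_card_cliqueTuples_lt.{u} c
    -- Chosen so that averaging yields inner density `ε ^ 2`: divided by the penalty `2 * ε * n`,
    -- the inner pairs account for only `O(εn)` unassigned vertices.
    (ε := ε ^ 2 * κ ^ (q + 1) / (q + 2)) (by positivity)
  obtain ⟨M, n₂, hM⟩ := exists_card_lt_of_dense_cliques_in_neighborhoods.{u} c
    (ε := ε ^ (q + 1)) (by positivity)
  refine ⟨M, n₁ + n₂ + 1, fun {V} _ G hV hfree hdeg => ?_⟩
  have hVpos : 0 < Fintype.card V := by omega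
  have : Nonempty V := Fintype.card_pos_iff.1 hVpos
  have hmany := pow_le_card_cliqueTuples (G := G) (q := q) hκ0.le hμ0 (by
    have := one_div_le_one_sub (by linarith : (2 : ℝ) ≤ q + 1) hh' hη hone
    rw [← hμ, add_sub_cancel_right] at this
    exact this) hdeg
  obtain ⟨x, -, hx⟩ := exists_clique_few_extensions G (ε₁ := ε ^ 2) hκ0 hVpos hmany
    (hn₁ G (by omega) hfree) (by rw [mul_div_cancel₀ _ (by positivity)])
  obtain ⟨f₀, hf₀, hf₀none⟩ := exists_partition_of_clique G hVpos hdeg x hx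
  obtain ⟨f, hf, hfnone, hfsome⟩ := exists_locally_optimal_partition G f₀
    (ε * (Fintype.card V : ℝ))
  set n : ℝ := (Fintype.card V : ℝ) with hn
  have hnpos : 0 < n := by rw [hn]; exact_mod_cast hVpos
  refine ⟨f, hM G _ (by omega) hfree fun v hv => ?_, hfsome⟩
  rw [← mul_pow]
  refine pow_le_card_cliques_in_neighborhood hq hh' hη hone hμ hε hdeg hfsome ?_
    (hfnone v (by simpa using hv))
  have h1 : 2 * (ε * n) * #{v | f v = none} ≤ 2 * (ε * n) * (((q + 1) * η + 3 * ε) * n) := by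
    have h2 : 2 * (ε * n) * #{v | f₀ v = none} ≤
        2 * (ε * n) * (((q + 1) * μ - 1 + 2 * ε ^ 2) * n) := by gcongr
    have h3 : (0 : ℝ) ≤ #(innerPairs G f) := Nat.cast_nonneg _
    have h4 : ((q : ℝ) + 1) * μ - 1 = (q + 1) * η := by rw [hμ]; linarith
    rw [h4] at h2
    have h5 : ε ^ 2 * n ^ 2 + 2 * (ε * n) * (2 * ε ^ 2 * n) ≤ 2 * (ε * n) * (3 * ε * n) := by
      have : ε * (ε ^ 2 * n ^ 2) ≤ 1 * (ε ^ 2 * n ^ 2) := by gcongr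
      linarith [sq_nonneg (ε * n)]
    linarith
  exact le_of_mul_le_mul_left h1 (by positivity)

/-- Inner adjacency preserves the part, so a biclique lies within one part. Dense cliques in its
common neighbourhood would then complete a copy of `H`. -/
theorem exists_innerGraph_biclique_free (c : H.Coloring (Fin (q + 2))) (hq : 1 ≤ q)
    (hh : q + 2 ≤ Fintype.card W) (hη : 0 < η)
    (hone : 3 * (Fintype.card W : ℝ) * (q + 1 : ℝ) ^ 2 * η = 1)
    (hμ : μ = (3 * (Fintype.card W : ℝ) * (q + 1) + 1) * η) (hε : ε = 3 / 100 * η) {s : ℕ}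
    (hs : 1 ≤ s) (hsW : s ≤ Fintype.card W) (hcs : #{w | c w = 0} ≤ s) :
    ∃ n₀ : ℕ, ∀ {V : Type u} [Fintype V] (G : SimpleGraph V) (f : V → Option (Fin (q + 1))),
      n₀ ≤ Fintype.card V → H.Free G → (∀ v, (1 - μ) * Fintype.card V ≤ G.degree v) →
      (#{w | f w = none} : ℝ) ≤ ε * Fintype.card V →
      (∀ v i, f v = some i → (#{w | f w = some i ∧ G.Adj v w} : ℝ) ≤ ε * Fintype.card V) →
      ∀ P Q : Finset V, #P = s → #Q = Fintype.card W →
        ¬ ∀ x ∈ P, ∀ y ∈ Q, (innerGraph G f).Adj x y := by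
  have hh' : (q + 1 : ℝ) + 1 ≤ Fintype.card W := by
    have : ((q + 2 : ℕ) : ℝ) ≤ Fintype.card W := by exact_mod_cast hh
    push_cast at this; linarith
  have hε0 : 0 < ε := by rw [hε]; positivity
  obtain ⟨n₀, hn₀⟩ := exists_not_dense_cliques_over_biclique.{u} c (ε := ε ^ q) (by positivity)
  refine ⟨n₀, fun {V} _ G f hV hfree hdeg hnone hinner P Q hP hQ hPQ => ?_⟩
  obtain ⟨x₀, hx₀⟩ := card_pos.1 (by omega : 0 < #P)
  obtain ⟨y₀, hy₀⟩ := card_pos.1 (by omega : 0 < #Q)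
  have : Nonempty V := ⟨x₀⟩
  obtain ⟨i₀, hi₀⟩ := Option.ne_none_iff_exists'.1 (hPQ x₀ hx₀ y₀ hy₀).2.2
  have hQi : ∀ y ∈ Q, f y = some i₀ := fun y hy => (hPQ x₀ hx₀ y hy).2.1 ▸ hi₀
  have hPi : ∀ x ∈ P, f x = some i₀ := fun x hx => (hPQ x hx y₀ hy₀).2.1.trans (hQi y₀ hy₀)
  have h1 := pow_le_card_cliques_over_biclique hq hh' hη hone hμ hε hdeg hinner hnone
    (Z := P ∪ Q) (i₀ := i₀)
    (fun z hz => (mem_union.1 hz).elim (hPi z) (hQi z))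
    (by
      have := card_union_le P Q
      have h2 : #(P ∪ Q) ≤ 2 * Fintype.card W := by omega
      exact_mod_cast h2)
  have h2 := hn₀ G P Q hV hfree (hcs.trans hP.ge) hQ.ge fun x hx y hy => (hPQ x hx y hy).1
  rw [← mul_pow] at h2
  exact absurd h1 (not_le.2 h2)

end Existence

theorem exists_coloring_card_fiber_zero_le {W : Type v} [Fintype W] {H : SimpleGraph W} {k : ℕ}
    (hcol : H.Colorable (k + 1)) :
    ∃ c : H.Coloring (Fin (k + 1)), #{w | c w = 0} ≤ Fintype.card W / (k + 1) := by
  obtain ⟨c⟩ := hcol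
  obtain ⟨j, hj⟩ : ∃ j, #{w | c w = j} ≤ Fintype.card W / (k + 1) := by
    by_contra! hlt
    have h1 := card_eq_sum_card_fiberwise (s := (univ : Finset W)) (t := univ) (f := c)
      (fun _ _ => mem_coe.2 (mem_univ _))
    have h2 := sum_le_sum fun j (_ : j ∈ (univ : Finset (Fin (k + 1)))) =>
      Nat.succ_le_of_lt (hlt j)
    rw [sum_const, card_univ, Fintype.card_fin, smul_eq_mul, ← h1, card_univ] at h2
    have h3 := Nat.lt_mul_div_succ (Fintype.card W) (Nat.succ_pos k)
    exact absurd h2 (not_le.2 h3)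
  refine ⟨SimpleGraph.Coloring.mk (fun w => Equiv.swap 0 j (c w))
    fun hab h => c.valid hab ((Equiv.swap 0 j).injective h), ?_⟩
  refine (le_of_eq (congrArg card ?_)).trans hj
  ext w
  simp only [mem_filter, mem_univ, true_and]
  change Equiv.swap 0 j (c w) = 0 ↔ c w = j
  rw [Equiv.swap_apply_eq_iff, Equiv.swap_apply_left]

/-- Deleting the inner edges and the edges at unassigned vertices leaves an `r`-partite graph. -/
theorem exists_deleted_edges_of_partition {r : ℕ} (G : SimpleGraph V)
    (f : V → Option (Fin (r + 1))) :
    ∃ D : Finset (Sym2 V), (D : Set (Sym2 V)) ⊆ G.edgeSet ∧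
      (D.card : ℝ) ≤ ∑ v, ((innerGraph G f).degree v : ℝ) +
        #{v | f v = none} * (Fintype.card V : ℝ) ∧
      (G.deleteEdges (D : Set (Sym2 V))).Colorable (r + 1) := by
  set B : Finset V := {v | f v = none} with hB
  refine ⟨(innerGraph G f).edgeFinset ∪ B.biUnion fun v => G.incidenceFinset v, ?_, ?_, ?_⟩
  · intro e he
    simp only [coe_union, Set.mem_union, mem_coe, mem_biUnion] at he
    rcases he with he | ⟨v, -, hv⟩
    · rw [SimpleGraph.mem_edgeFinset] at he
      revert he
      refine Sym2.ind (fun a b hab => ?_) e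
      exact hab.1
    · rw [SimpleGraph.mem_incidenceFinset] at hv
      exact hv.1
  · have h1 := (innerGraph G f).sum_degrees_eq_twice_card_edges
    have h2 : #(B.biUnion fun v => G.incidenceFinset v) ≤ #B * Fintype.card V :=
      card_biUnion_le_card_mul _ _ _ fun v _ => by
        rw [G.card_incidenceFinset_eq_degree]; exact (G.degree_lt_card_verts v).le
    have h3 := card_union_le (innerGraph G f).edgeFinset (B.biUnion fun v => G.incidenceFinset v)
    have h4 : #((innerGraph G f).edgeFinset ∪ B.biUnion fun v => G.incidenceFinset v) ≤
        ∑ v, (innerGraph G f).degree v + #B * Fintype.card V := by omega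
    exact_mod_cast h4
  -- The default colour is harmless: unassigned vertices have lost all their edges.
  · refine ⟨SimpleGraph.Coloring.mk (fun v => (f v).getD 0) ?_⟩
    intro u v huv h
    rw [SimpleGraph.deleteEdges_adj] at huv
    obtain ⟨hadj, hD⟩ := huv
    simp only [coe_union, Set.mem_union, mem_coe, mem_biUnion, not_or, not_exists, not_and,
      SimpleGraph.mem_edgeFinset, SimpleGraph.mem_edgeSet, SimpleGraph.mem_incidenceFinset] at hD
    have hu : f u ≠ none := fun h0 => hD.2 u (by simpa [hB] using h0)
      ⟨hadj, Sym2.mem_mk_left _ _⟩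
    have hv : f v ≠ none := fun h0 => hD.2 v (by simpa [hB] using h0)
      ⟨hadj, Sym2.mem_mk_right _ _⟩
    obtain ⟨i, hi⟩ := Option.ne_none_iff_exists'.1 hu
    obtain ⟨j, hj⟩ := Option.ne_none_iff_exists'.1 hv
    rw [hi, hj] at h
    refine hD.1 ⟨hadj, ?_, hu⟩
    rw [hi, hj]
    exact congrArg some h

theorem exists_few_edges_of_large_degree {W : Type v} [Fintype W] (H : SimpleGraph W) {q : ℕ}
    (hq : 1 ≤ q) (hcol : H.Colorable (q + 2)) (hh : q + 2 ≤ Fintype.card W) :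
    ∃ C : ℝ, 0 < C ∧ ∀ (V : Type u) [Fintype V] (G : SimpleGraph V), H.Free G →
      (∀ v, ((((q + 1 : ℕ) : ℝ) - 1) / (q + 1 : ℕ) -
          1 / (3 * (Fintype.card W : ℝ) * ((q + 1 : ℕ) : ℝ) ^ 2)) * (Fintype.card V : ℝ)
        ≤ G.degree v) →
      ∃ D : Finset (Sym2 V), (D : Set (Sym2 V)) ⊆ G.edgeSet ∧
        (D.card : ℝ) ≤
          C * (Fintype.card V : ℝ) ^ (2 - (((q + 1 : ℕ) : ℝ) + 1) / (Fintype.card W : ℝ)) ∧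
        (G.deleteEdges (D : Set (Sym2 V))).Colorable (q + 1) := by
  obtain ⟨c, hc⟩ := exists_coloring_card_fiber_zero_le hcol
  set h : ℝ := (Fintype.card W : ℝ) with hhdef
  have hhq : (q : ℝ) + 2 ≤ h := by rw [hhdef]; exact_mod_cast hh
  have hh0 : 0 < h := lt_of_lt_of_le (by positivity) hhq
  set s : ℕ := Fintype.card W / (q + 2) with hsdef
  have hs : 1 ≤ s := (Nat.one_le_div_iff (by omega)).2 hh
  have hsW : s ≤ Fintype.card W := Nat.div_le_self _ _
  set η : ℝ := 1 / (3 * h * ((q : ℝ) + 1) ^ 2) with hη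
  have hη0 : 0 < η := by positivity
  have hone : 3 * h * ((q : ℝ) + 1) ^ 2 * η = 1 := mul_one_div_cancel (by positivity)
  set μ : ℝ := (3 * h * (q + 1) + 1) * η with hμ
  set ε : ℝ := 3 / 100 * η with hε
  have hε0 : 0 < ε := by positivity
  obtain ⟨M, n₁, hM⟩ :=
    exists_partition_with_bounded_exceptional_set.{u} c hq hh hη0 hone hμ hε
  obtain ⟨n₂, hn₂⟩ :=
    exists_innerGraph_biclique_free.{u} c hq hh hη0 hone hμ hε hs hsW hc
  -- From `n₃` on, the bounded exceptional set has at most `εn` vertices, as the biclique step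
  -- requires.
  obtain ⟨n₃, hn₃⟩ := exists_nat_gt (M / ε)
  refine ⟨n₁ + n₂ + n₃ + M + h + s + 1, by positivity, fun V _ G hfree hdeg => ?_⟩
  set n : ℝ := (Fintype.card V : ℝ) with hn
  have hn0 : 0 ≤ n := Nat.cast_nonneg _
  set e : ℝ := 2 - (((q + 1 : ℕ) : ℝ) + 1) / h with he
  have he1 : 1 ≤ e := by
    have : (((q + 1 : ℕ) : ℝ) + 1) / h ≤ 1 := by
      rw [div_le_one hh0]; push_cast; linarith
    linarith
  have hdeg' : ∀ v, (1 - μ) * n ≤ G.degree v := by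
    intro v
    refine le_of_eq_of_le ?_ (hdeg v)
    congr 1
    have h1 : (((q + 1 : ℕ) : ℝ) - 1) / (q + 1 : ℕ) = 1 - 3 * h * (q + 1) * η := by
      push_cast
      rw [div_eq_iff (by positivity)]
      linarith
    rw [h1, hμ, hη]
    push_cast
    ring
  obtain hV0 | hVpos := Nat.eq_zero_or_pos (Fintype.card V)
  · have : IsEmpty V := Fintype.card_eq_zero_iff.1 hV0
    refine ⟨∅, by simp, ?_, ⟨SimpleGraph.Coloring.mk (fun v => isEmptyElim v)
      fun {v} => isEmptyElim v⟩⟩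
    simp only [card_empty, Nat.cast_zero]
    positivity
  have hn1 : 1 ≤ n := by rw [hn]; exact_mod_cast hVpos
  have hne : n ≤ n ^ e := by
    conv_lhs => rw [← Real.rpow_one n]
    exact Real.rpow_le_rpow_of_exponent_le hn1 he1
  have hne0 : 0 ≤ n ^ e := by positivity
  by_cases hV : n₁ + n₂ + n₃ ≤ Fintype.card V
  · obtain ⟨f, hfB, hf⟩ := hM G (by omega) hfree hdeg'
    have hBM : (#{v | f v = none} : ℝ) ≤ M := by exact_mod_cast hfB.le
    have hMε : (M : ℝ) ≤ ε * n := by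
      rw [div_lt_iff₀ hε0] at hn₃
      have : (n₃ : ℝ) ≤ n := by rw [hn]; exact_mod_cast (by omega : n₃ ≤ Fintype.card V)
      nlinarith
    have hfree' := hn₂ G f (by omega) hfree hdeg' (hBM.trans hMε) hf
    have hkst := sum_degree_le_of_biclique_free (innerGraph G f) hs (hs.trans hsW) hfree'
    obtain ⟨D, hD, hDcard, hDcol⟩ := exists_deleted_edges_of_partition G f
    refine ⟨D, hD, hDcard.trans ?_, hDcol⟩
    -- Rounding down in `s` goes the right way: `s * (q + 2) ≤ h`.
    have hexp : n ^ (2 - 1 / (s : ℝ)) ≤ n ^ e := by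
      refine Real.rpow_le_rpow_of_exponent_le hn1 ?_
      have hs' : (0 : ℝ) < s := by exact_mod_cast hs
      have h1 : (s : ℝ) * (q + 2) ≤ h := by
        rw [hhdef]; exact_mod_cast Nat.div_mul_le_self (Fintype.card W) (q + 2)
      have h2 : (((q + 1 : ℕ) : ℝ) + 1) / h ≤ 1 / s := by
        rw [div_le_div_iff₀ hh0 hs']; push_cast; linarith
      rw [he]; linarith
    calc _ ≤ (h + s) * n ^ (2 - 1 / (s : ℝ)) + M * n := by gcongr
      _ ≤ (h + s) * n ^ e + M * n ^ e := by gcongr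
      _ = (M + h + s) * n ^ e := by ring
      _ ≤ _ := by
        refine mul_le_mul_of_nonneg_right ?_ hne0
        have : (0 : ℝ) ≤ (n₁ : ℝ) + n₂ + n₃ := by positivity
        linarith
  -- For small `n`, leaving every vertex unassigned deletes all edges; `n * n` is absorbed by the
  -- constant because the exponent is at least `1`.
  · obtain ⟨D, hD, hDcard, hDcol⟩ := exists_deleted_edges_of_partition (r := q) G fun _ => none
    refine ⟨D, hD, hDcard.trans ?_, hDcol⟩
    have h0 : ∀ v, (innerGraph G fun _ => (none : Option (Fin (q + 1)))).degree v = 0 := by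
      intro v
      rw [SimpleGraph.degree_eq_zero]
      exact fun w hw => hw.2.2 rfl
    have hnle : n ≤ n₁ + n₂ + n₃ := by rw [hn]; exact_mod_cast (by omega)
    simp only [h0, Nat.cast_zero, sum_const_zero, zero_add, filter_true, card_univ]
    calc n * n ≤ (n₁ + n₂ + n₃) * n ^ e := by gcongr
      _ ≤ _ := by
        refine mul_le_mul_of_nonneg_right ?_ hne0
        have : (0 : ℝ) ≤ (M : ℝ) + h + s + 1 := by positivity
        linarith

end Main

theorem theorem6p4 {W : Type*} [Fintype W] (H : SimpleGraph W) (r : ℕ) (hr : 3 ≤ r + 1)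
    (hH : H.chromaticNumber = ((r + 1 : ℕ) : ℕ∞)) :
    ∃ C : ℝ, 0 < C ∧
      ∀ (V : Type*) [Fintype V] (G : SimpleGraph V) [DecidableRel G.Adj],
        H.Free G →
        (((r : ℝ) - 1) / r - 1 / (3 * (Fintype.card W : ℝ) * (r : ℝ) ^ 2)) * (Fintype.card V : ℝ)
          ≤ (G.minDegree : ℝ) →
        ∃ D : Finset (Sym2 V), (D : Set (Sym2 V)) ⊆ G.edgeSet ∧
          (D.card : ℝ) ≤
            C * (Fintype.card V : ℝ) ^ (2 - ((r : ℝ) + 1) / (Fintype.card W : ℝ)) ∧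
          (G.deleteEdges (D : Set (Sym2 V))).Colorable r := by
  obtain ⟨q, rfl⟩ : ∃ q, r = q + 1 := ⟨r - 1, by omega⟩
  have hcol : H.Colorable (q + 2) := SimpleGraph.chromaticNumber_le_iff_colorable.1 hH.le
  have hcard : q + 2 ≤ Fintype.card W := by
    have := SimpleGraph.chromaticNumber_le_card (G := H)
    rw [hH] at this
    exact_mod_cast this
  obtain ⟨C, hC, hmain⟩ := exists_few_edges_of_large_degree H (by omega : 1 ≤ q) hcol hcard
  refine ⟨C, hC, fun V _ G _ hfree hdeg => hmain V G hfree fun v => hdeg.trans ?_⟩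
  have h := G.minDegree_le_degree v
  norm_cast
  convert h
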